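/- Throughout, $E$ is a field of characteristic zero, $D_y$ is the derivation $d/dy$ on $E(y)$ (and its extension to differential field extensions of $E(y)$). A nonzero element $H$ of a differential field extension $\Phi$ of $E(y)$ is \emph{hyperexponential} over $E(y)$ if $D_y(H)/H\in E(y)$, and a hyperexponential $H$ is \emph{integrable} if $H=D_y(G)$ for some hyperexponential $G$. For $f\in E(y)$, $\exp(\int f\,dy)$ denotes a hyperexponential function with logarithmic derivative $f$. A rational function $a/b\in E(y)$ in lowest terms is \emph{differential-reduced} if $\gcd(b,\,a-i\,D_y(b))=1$ for all $i\in\mathbb Z$. We say that $f\in E(y)$ has \emph{kernel} $K\in E(y)$ and \emph{shell} $S\in E(y)\setminus\{0\}$ if $K$ is differential-reduced, the denominators of $S$ and $K$ are coprime, and $f=K+D_y(S)/S$. Write $K=k_1/k_2$ with coprime $k_1,k_2\in E[y]$, let $\mathcal M_K=\{k_2D_y(p)+k_1p \mid p\in E[y]\}$, and let $\mathcal N_K$ be the $E$-span of the powers $y^\ell$ such that $\ell$ is not the degree of a nonzero element of $\mathcal M_K$ (equivalently, not the degree of an element of an echelon basis of $\mathcal M_K$, i.e. of an $E$-basis whose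 elements have pairwise distinct degrees). A rational function $r\in E(y)$ is a \emph{residual form} with respect to $K$ if $$r=\frac qb+\frac v{k_2}$$ with $q,b\in E[y]$, $b$ squarefree, $\gcd(b,k_2)=1$, $\deg q<\deg b$, and $v\in\mathcal N_K$; it is a residual form \emph{of} $f\in E(y)$ with respect to $K$ if, in addition, $f=D_y(g)+Kg+r$ for some $g\in E(y)$. \textbf{Theorem (Hermite reduction for hyperexponential functions).} Let $H$ be a hyperexponential function over $E(y)$ whose logarithmic derivative has kernel $K$ and shell $S$, and let $T=\exp(\int K\,dy)$ be normalized so that $H=S\,T$. Then there is an algorithm that, given $K$ and $S$, computes a rational function $h\in E(y)$ and a residual form $r\in E(y)$ of $S$ with respect to $K$ such that $$H=D_y(h\,T)+r\,T .$$ The residual form $r$ is unique: if $H=D_y(h'T)+r'T$ with $h'\in E(y)$ and $r'$ a residual form with respect to $K$, then $r'=r$. Moreover, $H$ is integrable if and only if $r=0$. Here an algorithm is a single program, independent of $E$, $K$, $S$ and $H$, that works on the coefficient lists of numerators and denominators, halts on every such input, and uses the constant $1$, the field operations of $E$, the test whether an element of $E$ is zero, and the test whether an element of $E$ is a natural number.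 -/

import Mathlib

open scoped Polynomial Differential

/-! ### The differential field `E(y)` -/

namespace RatDeriv

/-- The derivative `d/dy` of a rational function, by the quotient rule on its reduced fraction. -/
noncomputable def fn {E : Type*} [Field E] (f : RatFunc E) : RatFunc E :=
  (algebraMap E[X] (RatFunc E) (Polynomial.derivative f.num) *
      algebraMap E[X] (RatFunc E) f.denom -
    algebraMap E[X] (RatFunc E) f.num *
      algebraMap E[X] (RatFunc E) (Polynomial.derivative f.denom)) /
    algebraMap E[X] (RatFunc E) f.denom ^ 2

/-- The quotient rule holds for every way of writing a rational function as a fraction. -/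
theorem fn_div {E : Type*} [Field E] (p q : E[X]) (hq : q ≠ 0) :
    fn (algebraMap E[X] (RatFunc E) p / algebraMap E[X] (RatFunc E) q) =
      (algebraMap E[X] (RatFunc E) (Polynomial.derivative p) * algebraMap E[X] (RatFunc E) q -
        algebraMap E[X] (RatFunc E) p * algebraMap E[X] (RatFunc E) (Polynomial.derivative q)) /
        algebraMap E[X] (RatFunc E) q ^ 2 := by
  set f := algebraMap E[X] (RatFunc E) p / algebraMap E[X] (RatFunc E) q with hf
  have hd : f.denom ≠ 0 := f.denom_ne_zero
  have hq' : algebraMap E[X] (RatFunc E) q ≠ 0 := RatFunc.algebraMap_ne_zero hq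
  have hd' : algebraMap E[X] (RatFunc E) f.denom ≠ 0 := RatFunc.algebraMap_ne_zero hd
  have hcross : f.num * q = p * f.denom := by
    apply RatFunc.algebraMap_injective E
    have h := f.num_div_denom
    rw [map_mul, map_mul]
    rw [div_eq_iff hd'] at h
    rw [h, hf]
    field_simp
  have hder := congrArg Polynomial.derivative hcross
  rw [Polynomial.derivative_mul, Polynomial.derivative_mul] at hder
  have h1 := congrArg (algebraMap E[X] (RatFunc E)) hcross
  have h2 := congrArg (algebraMap E[X] (RatFunc E)) hder
  simp only [map_mul, map_add] at h1 h2
  unfold fn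
  rw [div_eq_div_iff (pow_ne_zero 2 hd') (pow_ne_zero 2 hq')]
  linear_combination
    (algebraMap E[X] (RatFunc E) q * algebraMap E[X] (RatFunc E) f.denom) * h2 -
    (algebraMap E[X] (RatFunc E) (Polynomial.derivative f.denom) *
        algebraMap E[X] (RatFunc E) q +
      algebraMap E[X] (RatFunc E) f.denom *
        algebraMap E[X] (RatFunc E) (Polynomial.derivative q)) * h1

theorem exists_div {E : Type*} [Field E] (f : RatFunc E) :
    ∃ p q : E[X], q ≠ 0 ∧
      f = algebraMap E[X] (RatFunc E) p / algebraMap E[X] (RatFunc E) q :=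
  ⟨f.num, f.denom, f.denom_ne_zero, f.num_div_denom.symm⟩

theorem fn_add {E : Type*} [Field E] (f g : RatFunc E) : fn (f + g) = fn f + fn g := by
  obtain ⟨p, q, hq, rfl⟩ := exists_div f
  obtain ⟨s, t, ht, rfl⟩ := exists_div g
  have hq' : algebraMap E[X] (RatFunc E) q ≠ 0 := RatFunc.algebraMap_ne_zero hq
  have ht' : algebraMap E[X] (RatFunc E) t ≠ 0 := RatFunc.algebraMap_ne_zero ht
  rw [div_add_div _ _ hq' ht', ← map_mul, ← map_mul, ← map_add, ← map_mul,
    fn_div _ _ (mul_ne_zero hq ht), fn_div _ _ hq, fn_div _ _ ht]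
  simp only [Polynomial.derivative_mul, map_add, map_mul]
  field_simp
  ring

theorem fn_mul {E : Type*} [Field E] (f g : RatFunc E) :
    fn (f * g) = f * fn g + g * fn f := by
  obtain ⟨p, q, hq, rfl⟩ := exists_div f
  obtain ⟨s, t, ht, rfl⟩ := exists_div g
  have hq' : algebraMap E[X] (RatFunc E) q ≠ 0 := RatFunc.algebraMap_ne_zero hq
  have ht' : algebraMap E[X] (RatFunc E) t ≠ 0 := RatFunc.algebraMap_ne_zero ht
  rw [div_mul_div_comm, ← map_mul, ← map_mul,
    fn_div _ _ (mul_ne_zero hq ht), fn_div _ _ hq, fn_div _ _ ht]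
  simp only [Polynomial.derivative_mul, map_add, map_mul]
  field_simp
  ring

end RatDeriv

/-- A commutative ring with an additive map that satisfies the product rule. -/
@[reducible]
def RatDeriv.differentialOf {R : Type*} [CommRing R] (D : R → R)
    (hadd : ∀ a b, D (a + b) = D a + D b) (hmul : ∀ a b, D (a * b) = a * D b + b * D a) :
    Differential R where
  deriv := Derivation.mk' (AddMonoidHom.mk' D hadd).toIntLinearMap hmul

/-- The differential field `(E(y), d/dy)`. -/
noncomputable instance RatFunc.instDifferential {E : Type*} [Field E] :
    Differential (RatFunc E) :=
  RatDeriv.differentialOf RatDeriv.fn RatDeriv.fn_add RatDeriv.fn_mul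

/-- On polynomials, the derivation of `E(y)` is the usual derivative. -/
theorem RatFunc.deriv_algebraMap_polynomial {E : Type*} [Field E] (p : E[X]) :
    (algebraMap E[X] (RatFunc E) p)′ =
      algebraMap E[X] (RatFunc E) (Polynomial.derivative p) := by
  have h := RatDeriv.fn_div p 1 one_ne_zero
  simp only [map_one, div_one, Polynomial.derivative_one, map_zero, mul_one, mul_zero, sub_zero,
    one_pow] at h
  exact h

/-! ### Hyperexponential functions -/

namespace Hyperexp

/-- `H` is a function `exp (∫ f dy)`: a nonzero element, of a differential field extension of
`E(y)`, with logarithmic derivative `f`. -/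
def IsExpIntegral {E Φ : Type*} [Field E] [Field Φ] [Differential Φ] [Algebra (RatFunc E) Φ]
    (f : RatFunc E) (H : Φ) : Prop :=
  H ≠ 0 ∧ H′ / H = algebraMap (RatFunc E) Φ f

/-- `H` is hyperexponential over `E(y)`. -/
def IsHyperexponential (E : Type*) {Φ : Type*} [Field E] [Field Φ] [Differential Φ]
    [Algebra (RatFunc E) Φ] (H : Φ) : Prop :=
  ∃ f : RatFunc E, IsExpIntegral f H

/-- `H` is hyperexponential integrable: it is the derivative of a hyperexponential function. -/
def IsHyperexpIntegrable (E : Type*) {Φ : Type*} [Field E] [Field Φ] [Differential Φ]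
    [Algebra (RatFunc E) Φ] (H : Φ) : Prop :=
  ∃ G : Φ, IsHyperexponential E G ∧ G′ = H

/-- `a / b` (in lowest terms) is differential-reduced if `gcd (b, a - i b') = 1` for all
integers `i`. -/
def IsDifferentialReduced {E : Type*} [Field E] (K : RatFunc E) : Prop :=
  ∀ i : ℤ, IsCoprime K.denom (K.num - (i : E[X]) * Polynomial.derivative K.denom)

/-- `K` and `S` are the kernel and the shell of `f`, that is, `(K, S)` is a differential rational
canonical form of `f`. -/
structure IsKernelShell {E : Type*} [Field E] (f K S : RatFunc E) : Prop where
  reduced : IsDifferentialReduced K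
  shell_ne_zero : S ≠ 0
  coprime : IsCoprime S.denom K.denom
  eq : f = K + S′ / S

/-! ### Residual forms -/

/-- The map for polynomial reduction with respect to `K = k₁ / k₂` (in lowest terms):
`p ↦ k₂ p' + k₁ p`. -/
noncomputable def reductionMap {E : Type*} [Field E] (K : RatFunc E) : E[X] →ₗ[E] E[X] :=
  LinearMap.mulLeft E K.denom ∘ₗ Polynomial.derivative + LinearMap.mulLeft E K.num

/-- The subspace for polynomial reduction: `{k₂ p' + k₁ p | p ∈ E[y]}`. -/
noncomputable def reductionSubspace {E : Type*} [Field E] (K : RatFunc E) : Submodule E E[X] :=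
  LinearMap.range (reductionMap K)

/-- The standard complement of a subspace `M` of `E[y]`: the span of the powers `y ^ ℓ` such that
`ℓ` is not the degree of a nonzero element of `M`. By `standardComplement_eq_of_echelon` below it
suffices to look at the degrees of the elements of an echelon basis of `M`. -/
noncomputable def standardComplement {E : Type*} [Field E] (M : Submodule E E[X]) :
    Submodule E E[X] :=
  Submodule.span E {m | ∃ l : ℕ, (∀ f ∈ M, f ≠ 0 → f.natDegree ≠ l) ∧ m = Polynomial.X ^ l}

/-- An echelon basis of `M`: a basis whose distinct elements have distinct degrees. -/
structure IsEchelonBasis {E : Type*} [Field E] (M : Submodule E E[X]) (B : Set E[X]) : Prop where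
  linearIndependent : LinearIndependent E (fun b : B => (b : E[X]))
  span_eq : Submodule.span E B = M
  degree_injOn : Set.InjOn Polynomial.natDegree B

theorem standardComplement_eq_of_echelon {E : Type*} [Field E] {M : Submodule E E[X]}
    {B : Set E[X]} (hB : IsEchelonBasis M B) :
    standardComplement M =
      Submodule.span E {m | ∃ l : ℕ, (∀ f ∈ B, f.natDegree ≠ l) ∧ m = Polynomial.X ^ l} := by
  have hB0 : ∀ f ∈ B, f ≠ 0 := fun f hf => hB.linearIndependent.ne_zero ⟨f, hf⟩
  have hBM : ∀ f ∈ B, f ∈ M := fun f hf => hB.span_eq ▸ Submodule.subset_span hf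
  have key : ∀ f ∈ M, f ≠ 0 → ∃ b ∈ B, b.natDegree = f.natDegree := by
    intro f hf hf0
    rw [← hB.span_eq, Submodule.mem_span_set] at hf
    obtain ⟨c, hc, rfl⟩ := hf
    have hdeg : ∀ b ∈ c.support, (c b • b).degree = b.degree := by
      intro b hb
      rw [Polynomial.smul_eq_C_mul,
        Polynomial.degree_C_mul (Finsupp.mem_support_iff.mp hb)]
    have hsum : (c.sum fun mi r => r • mi).degree =
        c.support.sup fun b => (c b • b).degree := by
      apply Polynomial.degree_sum_eq_of_disjoint
      intro a ha b hb hab hEq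
      simp only [Function.comp, Set.mem_ofPred_eq] at ha hb hEq
      rw [hdeg a ha.1, hdeg b hb.1] at hEq
      exact hab (hB.degree_injOn (hc ha.1) (hc hb.1) (Polynomial.natDegree_eq_of_degree_eq hEq))
    have hne : c.support.Nonempty := by
      rw [Finset.nonempty_iff_ne_empty]
      intro h
      apply hf0
      simp [Finsupp.sum, h]
    obtain ⟨b, hb, hbs⟩ := Finset.exists_mem_eq_sup _ hne fun b => (c b • b).degree
    refine ⟨b, hc hb, ?_⟩
    apply Polynomial.natDegree_eq_of_degree_eq
    rw [hsum, hbs, hdeg b hb]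
  have hset : ∀ l : ℕ, (∀ f ∈ M, f ≠ 0 → f.natDegree ≠ l) ↔ ∀ f ∈ B, f.natDegree ≠ l := by
    intro l
    constructor
    · intro h f hf
      exact h f (hBM f hf) (hB0 f hf)
    · intro h f hf hf0
      obtain ⟨b, hb, hbf⟩ := key f hf hf0
      exact hbf ▸ h b hb
  unfold standardComplement
  simp only [hset]

/-- `r` is a residual form with respect to `K = k₁ / k₂`: `r = q / b + v / k₂`, where `b` is
squarefree and coprime to `k₂`, `deg q < deg b`, and `v` is in the standard complement of the
subspace for polynomial reduction. (`degree` is used with `degree 0 = ⊥`.) -/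
def IsResidualForm {E : Type*} [Field E] (K r : RatFunc E) : Prop :=
  ∃ q b v : E[X], Squarefree b ∧ IsCoprime b K.denom ∧ q.degree < b.degree ∧
    v ∈ standardComplement (reductionSubspace K) ∧
    r = algebraMap E[X] (RatFunc E) q / algebraMap E[X] (RatFunc E) b +
      algebraMap E[X] (RatFunc E) v / algebraMap E[X] (RatFunc E) K.denom

/-- `r` is a residual form of the rational function `f` with respect to `K`. -/
def IsResidualFormOf {E : Type*} [Field E] (K f r : RatFunc E) : Prop :=
  (∃ g : RatFunc E, f = g′ + K * g + r) ∧ IsResidualForm K r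

/-! ### Algorithms over an arbitrary field of characteristic zero

The data are finite binary trees whose leaves may carry field elements. The programs are those of
a WHILE language on such trees; the basic operations on field elements are the constant `1`, the
field operations, the test for zero, and the test for being a natural number. The text of a
program does not refer to a field, so that the same program can be run over every field. -/

/-- Finite binary trees with leaves that are empty or carry an element of `E`. -/
inductive Datum (E : Type*) where
  | nil : Datum E
  | elem (x : E) : Datum E
  | pair (a b : Datum E) : Datum E

/-- The empty tree stands for false, and this tree for true. -/
def Datum.tt {E : Type*} : Datum E := Datum.pair Datum.nil Datum.nil

/-- Programs. -/
inductive Program where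
  | id : Program
  | nil : Program
  | one : Program
  | fst : Program
  | snd : Program
  | add : Program
  | mul : Program
  | neg : Program
  | inv : Program
  | isZero : Program
  | isNat : Program
  | pair (f g : Program) : Program
  | comp (g f : Program) : Program
  | cond (c f g : Program) : Program
  | loop (c f : Program) : Program

/-- One round of the loop `while c do f`: stop with the current tree if `c` fails on it, and
otherwise go on with the value of `f`. -/
def loopStep {E : Type*} (c f : Datum E →. Datum E) : Datum E →. Datum E ⊕ Datum E :=
  fun d => (c d).bind fun t => match t with
    | .nil => Part.some (Sum.inl d)
    | _ => (f d).map Sum.inr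

open Classical in
/-- The partial function on trees that a program computes over the field `E`; a run that does not
halt has no value. Basic operations return the empty tree on inputs of the wrong shape, and
`0⁻¹ = 0`.
* `pair f g` runs `f` and `g` on the input and pairs the results;
* `comp g f` runs `f`, then `g` on the result;
* `cond c f g` runs `f` on the input if the test `c` succeeds on it, and `g` otherwise;
* `loop c f` is the loop `while c do f`. -/
noncomputable def Program.eval {E : Type*} [Field E] : Program → Datum E →. Datum E
  | .id => fun d => Part.some d
  | .nil => fun _ => Part.some .nil
  | .one => fun _ => Part.some (.elem 1)
  | .fst => fun d => match d with
    | .pair a _ => Part.some a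
    | _ => Part.some .nil
  | .snd => fun d => match d with
    | .pair _ b => Part.some b
    | _ => Part.some .nil
  | .add => fun d => match d with
    | .pair (.elem x) (.elem y) => Part.some (.elem (x + y))
    | _ => Part.some .nil
  | .mul => fun d => match d with
    | .pair (.elem x) (.elem y) => Part.some (.elem (x * y))
    | _ => Part.some .nil
  | .neg => fun d => match d with
    | .elem x => Part.some (.elem (-x))
    | _ => Part.some .nil
  | .inv => fun d => match d with
    | .elem x => Part.some (.elem x⁻¹)
    | _ => Part.some .nil
  | .isZero => fun d => match d with
    | .elem x => Part.some (if x = 0 then .tt else .nil)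
    | _ => Part.some .nil
  | .isNat => fun d => match d with
    | .elem x => Part.some (if ∃ n : ℕ, x = n then .tt else .nil)
    | _ => Part.some .nil
  | .pair f g => fun d =>
      (f.eval d).bind fun a => (g.eval d).bind fun b => Part.some (.pair a b)
  | .comp g f => fun d => (f.eval d).bind fun a => g.eval a
  | .cond c f g => fun d => (c.eval d).bind fun t => match t with
    | .nil => g.eval d
    | _ => f.eval d
  | .loop c f => PFun.fix (loopStep c.eval f.eval)

/-- A list of field elements as a tree. -/
def Datum.ofList {E : Type*} : List E → Datum E
  | [] => .nil
  | a :: l => .pair (.elem a) (Datum.ofList l)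

/-- The polynomial with the given list of coefficients, constant term first. -/
noncomputable def polyOfList {E : Type*} [Field E] : List E → E[X]
  | [] => 0
  | a :: l => Polynomial.C a + Polynomial.X * polyOfList l

/-- `d` represents the rational function `f`: it is the pair of the coefficient lists of two
polynomials `p` and `q ≠ 0` such that `f = p / q`. (The fraction need not be in lowest terms.) -/
def Datum.Represents {E : Type*} [Field E] (d : Datum E) (f : RatFunc E) : Prop :=
  ∃ lp lq : List E, d = .pair (.ofList lp) (.ofList lq) ∧ polyOfList lq ≠ 0 ∧
    f = algebraMap E[X] (RatFunc E) (polyOfList lp) / algebraMap E[X] (RatFunc E) (polyOfList lq)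

end Hyperexp

/-! Existence is a reduction in two stages. Let `p` be irreducible with `p ^ (j + 2)` exactly
dividing the denominator of the shell. As `p` does not divide `k₂`, multiplication by `K` creates no
new pole at `p`, so for a suitable `A` subtracting the image of `A / p ^ (j + 1)` under `g ↦ g′ + K
* g` lowers the exponent. Repetition leaves `q / b + w / k₂` with `b` separable
(`exists_hermite_reduction`). Next, `p ↦ k₂ p' + k₁ p` raises degrees by at most a fixed `D`, and
multiplies the coefficient of `X ^ n` by a factor that is affine in `n`. Unless `k₁ = 0` and `k₂` is
constant, this factor vanishes for at most one `n`, so the degrees in the image are explicit and `w`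
can be reduced modulo the image to an element of the standard complement (`exists_isReduced`).

Uniqueness: residual forms are closed under subtraction, so it is enough that a residual form equal
to `g′ + K * g` vanishes. A pole of `g` away from `k₂` would give a multiple pole, but `b` is
squarefree. At a factor of `k₂`, differential-reducedness prevents the leading terms from
cancelling, and the pole would exceed that of `1 / k₂` (`isUnit_of_mul_eq`). So `g` is a polynomial,
`b` divides `q`, hence `q = 0`, and `v` lies both in the reduction subspace and in its complement,
hence `v = 0` (`IsResidualForm.eq_zero`). A hyperexponential antiderivative of `S T` is a rational
multiple of `T`; thus integrability means that `0` is a residual form of `S`.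

The algorithm is an unbounded search. A certificate is a finite list of coefficient lists, checked
by polynomial identities and at most one test for natural numbers: Bézout identities express
coprimality, inverses express nonvanishing, and lengths of lists express degrees. A fair search runs
through all trees that the field operations build from the input (`eval_search`). It halts because
the reduction can be carried out over the subfield generated by the input coefficients
(`exists_holds_of_isCoprime`). It may stop at another certificate than the one from the reduction;
every list that passes the test is sound (`isCertificate_of_holds`). -/

namespace Hyperexp

universe u

/-! ### Evaluation of basic programs -/

namespace Datum

variable {E : Type u}

/-- The tree of a list of trees. -/
def seq : List (Datum E) → Datum E
  | [] => .nil
  | a :: l => .pair a (seq l)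

/-- The list of trees along the right spine; a field element at its end counts as one entry. -/
def spine : Datum E → List (Datum E)
  | .nil => []
  | .elem _ => [.nil]
  | .pair a b => a :: b.spine

@[simp] theorem spine_seq (l : List (Datum E)) : (seq l).spine = l := by
  induction l with
  | nil => rfl
  | cons a l ih => simp [seq, spine, ih]

theorem ofList_eq_seq (l : List E) : ofList l = seq (l.map elem) := by
  induction l with
  | nil => rfl
  | cons a l ih => simp [seq, ofList, ih]

@[simp] theorem spine_ofList (l : List E) : (ofList l).spine = l.map elem := by
  rw [ofList_eq_seq, spine_seq]

/-- The tree of a list of coefficient lists. -/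
def ofLists (l : List (List E)) : Datum E :=
  seq (l.map ofList)

/-- The field element on a leaf, and `0` for all other trees. -/
def val [Field E] : Datum E → E
  | .elem x => x
  | _ => 0

@[simp] theorem val_elem [Field E] (x : E) : (elem x).val = x := rfl

/-- The list of field elements that is read off a tree. -/
def toList [Field E] (d : Datum E) : List E :=
  d.spine.map val

/-- The list of lists of field elements that is read off a tree. -/
def toLists [Field E] (d : Datum E) : List (List E) :=
  d.spine.map toList

@[simp] theorem toList_ofList [Field E] (l : List E) : (ofList l).toList = l := by
  simp [toList, Function.comp_def, val]

@[simp] theorem toLists_ofLists [Field E] (l : List (List E)) : (ofLists l).toLists = l := by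
  simp [toLists, ofLists, Function.comp_def]

end Datum

namespace Program

section

variable {E : Type u}

open Classical in
/-- The tree of a truth value. -/
noncomputable def ofProp (p : Prop) : Datum E :=
  if p then .tt else .nil

theorem ofProp_of {p : Prop} (h : p) : (ofProp p : Datum E) = .pair .nil .nil := by
  simp [ofProp, h, Datum.tt]

theorem ofProp_of_not {p : Prop} (h : ¬p) : (ofProp p : Datum E) = .nil := by
  simp [ofProp, h]

end

variable {E : Type u} [Field E]

theorem eval_loop_of_nil {c f : Program} {d : Datum E} (hc : c.eval d = Part.some .nil) :
    (loop c f).eval d = Part.some d := by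
  rw [eval, Part.eq_some_iff]
  apply PFun.fix_stop
  simp [loopStep, hc]

theorem eval_loop_of_ne {c f : Program} {d d' t : Datum E} (hc : c.eval d = Part.some t)
    (ht : t ≠ .nil) (hf : f.eval d = Part.some d') :
    (loop c f).eval d = (loop c f).eval d' := by
  rw [eval]
  apply PFun.fix_fwd_eq
  cases t <;> simp_all [loopStep]

theorem eval_comp (g f : Program) (d : Datum E) :
    (comp g f).eval d = (f.eval d).bind g.eval := by
  simp only [eval]

theorem eval_comp_of {g f : Program} {d a : Datum E} (hf : f.eval d = Part.some a) :
    (comp g f).eval d = g.eval a := by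
  simp only [eval, hf, Part.bind_some]

theorem eval_pair_of {f g : Program} {d a b : Datum E} (hf : f.eval d = Part.some a)
    (hg : g.eval d = Part.some b) : (Program.pair f g).eval d = Part.some (.pair a b) := by
  simp only [eval, hf, hg, Part.bind_some]

/-- On `(e, (l, a))`, fold the step `f`, which is run on `(e, (x, a))`, over the entries `x` of
`l`, from the first to the last. -/
def fold (f : Program) : Program :=
  .comp (.comp .snd .snd) (.loop (.comp .fst .snd)
    (.pair .fst (.pair (.comp .snd (.comp .fst .snd))
      (.comp f (.pair .fst (.pair (.comp .fst (.comp .fst .snd)) (.comp .snd .snd)))))))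

/-- The accumulator is described through an encoding `enc` of a type of states, and the step is only
required to be right on entries of the list. Later evaluations of folds therefore reduce to an
ordinary `List.foldl` or `List.foldr`. -/
theorem eval_fold {α : Type*} (enc : α → Datum E) {f : Program} {e : Datum E}
    {F : Datum E → α → α} (d : Datum E)
    (hf : ∀ x ∈ d.spine, ∀ a, f.eval (.pair e (.pair x (enc a))) = Part.some (enc (F x a)))
    (a : α) :
    (fold f).eval (.pair e (.pair d (enc a))) =
      Part.some (enc (d.spine.foldl (fun a x => F x a) a)) := by
  have hnil : ∀ a : α, (fold f).eval (.pair e (.pair .nil (enc a))) = Part.some (enc a) := by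
    intro a
    rw [fold, eval_comp, eval_loop_of_nil (by simp [eval])]
    simp [eval]
  have hstep : ∀ (d x r : Datum E) (a : α), d ≠ .nil →
      Program.fst.eval d = Part.some x → Program.snd.eval d = Part.some r →
      f.eval (.pair e (.pair x (enc a))) = Part.some (enc (F x a)) →
      (fold f).eval (.pair e (.pair d (enc a))) =
        (fold f).eval (.pair e (.pair r (enc (F x a)))) := by
    intro d x r a hd hx hr hf
    rw [fold, eval_comp, eval_comp]
    rw [eval_loop_of_ne (t := d) (d' := .pair e (.pair r (enc (F x a)))) _ hd]
    · simp only [eval] at hx hr ⊢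
      simp only [Part.bind_some]
      simp [hx, hr, hf]
    · simp [eval]
  induction d generalizing a with
  | nil => simpa [Datum.spine] using hnil a
  | elem y =>
    -- A field element at the end of the spine is not the empty tree, so the loop runs once more;
    -- both projections of it are empty.
    rw [hstep (.elem y) .nil .nil a (by simp) rfl rfl (hf _ (by simp [Datum.spine]) _), hnil]
    simp [Datum.spine]
  | pair x r _ ih =>
    rw [hstep (.pair x r) x r a (by simp) rfl rfl (hf _ (by simp [Datum.spine]) _),
      ih (fun y hy => hf y (by simp [Datum.spine, hy]))]
    simp [Datum.spine]

/-- Reverse a list onto another one: on `(l, a)`. -/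
def revAppend : Program :=
  .comp (fold .snd) (.pair .nil .id)

theorem eval_revAppend (d : Datum E) (l : List (Datum E)) :
    revAppend.eval (.pair d (.seq l)) = Part.some (.seq (d.spine.reverse ++ l)) := by
  have h := eval_fold (E := E) Datum.seq (f := .snd) (e := .nil) (F := fun x l => x :: l) d
    (fun x _ a => by simp [eval, Datum.seq]) l
  simp only [revAppend, eval, Part.bind_some]
  rw [h]
  congr 2
  induction d.spine generalizing l with
  | nil => rfl
  | cons a s _ => simp

/-- On `(e, (l, a))`, fold the step `f` over the entries of `l`, from the last to the first. -/
def foldr (f : Program) : Program :=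
  .comp (fold f) (.pair .fst (.pair
    (.comp revAppend (.pair (.comp .fst .snd) .nil)) (.comp .snd .snd)))

theorem eval_foldr {α : Type*} (enc : α → Datum E) {f : Program} {e : Datum E}
    {F : Datum E → α → α} (d : Datum E)
    (hf : ∀ x ∈ d.spine, ∀ a, f.eval (.pair e (.pair x (enc a))) = Part.some (enc (F x a)))
    (a : α) :
    (foldr f).eval (.pair e (.pair d (enc a))) = Part.some (enc (d.spine.foldr F a)) := by
  have h1 := eval_revAppend d []
  have h2 := eval_fold enc (Datum.seq d.spine.reverse) (f := f) (e := e) (F := F)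
    (by simpa using hf) a
  rw [Datum.seq] at h1
  simp only [foldr, eval, Part.bind_some, h1]
  simp [h2]

/-! ### Reading off lists of field elements -/

/-- The field element `0`. -/
def zero : Program :=
  .comp .add (.pair .one (.comp .neg .one))

@[simp] theorem eval_zero (d : Datum E) : zero.eval d = Part.some (.elem 0) := by
  simp [zero, eval]

/-- The field element on a leaf, and `0` on all other trees. -/
def val : Program :=
  .cond .neg .id zero

@[simp] theorem eval_val (d : Datum E) : val.eval d = Part.some (.elem d.val) := by
  -- Here `neg` serves as the test: its result is nonempty exactly on a leaf that carries a field
  -- element.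
  cases d <;> simp [val, eval, Datum.val]

/-- Read off a list of field elements. -/
def toList : Program :=
  .comp (foldr (.pair (.comp val (.comp .fst .snd)) (.comp .snd .snd)))
    (.pair .nil (.pair .id .nil))

@[simp] theorem eval_toList (d : Datum E) :
    toList.eval d = Part.some (.ofList d.toList) := by
  have h := eval_foldr (E := E) Datum.ofList
    (f := .pair (.comp val (.comp .fst .snd)) (.comp .snd .snd)) (e := .nil)
    (F := fun x l => x.val :: l) d (fun x _ a => by simp [eval, Datum.ofList]) []
  rw [Datum.ofList] at h
  simp only [toList, eval, Part.bind_some, Datum.toList, List.map_eq_foldr, h]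

/-- Read off a list of lists of field elements. -/
def toLists : Program :=
  .comp (foldr (.pair (.comp toList (.comp .fst .snd)) (.comp .snd .snd)))
    (.pair .nil (.pair .id .nil))

@[simp] theorem eval_toLists (d : Datum E) :
    toLists.eval d = Part.some (.ofLists d.toLists) := by
  have h := eval_foldr (E := E) Datum.ofLists
    (f := .pair (.comp toList (.comp .fst .snd)) (.comp .snd .snd)) (e := .nil)
    (F := fun x l => x.toList :: l) d
    (fun x _ a => by simp [eval, Datum.ofLists, Datum.seq]) []
  rw [Datum.ofLists, List.map_nil, Datum.seq] at h
  simp only [toLists, eval, Part.bind_some, Datum.toLists, List.map_eq_foldr, h]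

/-! ### Polynomial arithmetic -/

/-- The program gives on `d` a coefficient list of `p`. -/
def EvalsToPoly (P : Program) (d : Datum E) (p : E[X]) : Prop :=
  ∃ l : List E, P.eval d = Part.some (.ofList l) ∧ polyOfList l = p

/-- Multiply the entries of a list by a scalar: on `(c, l)`. -/
def scale : Program :=
  .comp (foldr (.pair (.comp .mul (.pair .fst (.comp .fst .snd))) (.comp .snd .snd)))
    (.pair .fst (.pair .snd .nil))

theorem eval_scale (c : E) (l : List E) :
    scale.eval (.pair (.elem c) (.ofList l)) = Part.some (.ofList (l.map (c * ·))) := by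
  have h := eval_foldr (E := E) Datum.ofList
    (f := .pair (.comp .mul (.pair .fst (.comp .fst .snd))) (.comp .snd .snd)) (e := .elem c)
    (F := fun x l => c * x.val :: l) (.ofList l)
    (fun x hx a => by
      rw [Datum.spine_ofList, List.mem_map] at hx
      obtain ⟨x, -, rfl⟩ := hx
      simp [eval, Datum.ofList, Datum.val_elem]) []
  rw [Datum.ofList, Datum.spine_ofList] at h
  simp only [scale, eval, Part.bind_some, h]
  congr 2
  induction l with
  | nil => rfl
  | cons a l _ => simp [Datum.val_elem]

theorem polyOfList_scale (c : E) (l : List E) :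
    polyOfList (l.map (c * ·)) = Polynomial.C c * polyOfList l := by
  induction l with
  | nil => simp [polyOfList]
  | cons a l ih => simp [polyOfList, ih]; ring

/-- The coefficient list of a sum. -/
def addList : List E → List E → List E
  | [], q => q
  | a :: p, [] => a :: p
  | a :: p, b :: q => (b + a) :: addList p q

@[simp] theorem addList_nil (p : List E) : addList p [] = p := by
  cases p <;> rfl

theorem polyOfList_addList (p q : List E) :
    polyOfList (addList p q) = polyOfList p + polyOfList q := by
  induction p generalizing q with
  | nil => simp [addList, polyOfList]
  | cons a p ih =>
    cases q with
    | nil => simp [polyOfList]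
    | cons b q => simp [addList, polyOfList, ih]; ring

/-- One step of the addition of coefficient lists: on `(e, (x, (q, out)))`. -/
def addStep : Program :=
  .cond (.comp .fst (.comp .snd .snd))
    (.pair (.comp .snd (.comp .fst (.comp .snd .snd)))
      (.pair (.comp .add (.pair (.comp .fst (.comp .fst (.comp .snd .snd))) (.comp .fst .snd)))
        (.comp .snd (.comp .snd .snd))))
    (.pair .nil (.pair (.comp .fst .snd) (.comp .snd (.comp .snd .snd))))

/-- Add two coefficient lists: on `(p, q)`. -/
def polyAdd : Program :=
  .comp revAppend (.comp (.pair .snd .fst)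
    (.comp (fold addStep) (.pair .nil (.pair .fst (.pair .snd .nil)))))

theorem eval_polyAdd (p q : List E) :
    polyAdd.eval (.pair (.ofList p) (.ofList q)) = Part.some (.ofList (addList p q)) := by
  -- A state consists of the part of `q` not yet used and the sum so far in reverse order. If `q` is
  -- longer than `p`, its remainder is the tail of the result.
  let enc : List E × List E → Datum E := fun a => .pair (.ofList a.1) (.ofList a.2)
  let F : Datum E → List E × List E → List E × List E := fun x a =>
    match a.1 with
    | [] => ([], x.val :: a.2)
    | b :: q => (q, (b + x.val) :: a.2)
  have h := eval_fold (E := E) enc (f := addStep) (e := .nil) (F := F) (.ofList p)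
    (fun x hx a => by
      rw [Datum.spine_ofList, List.mem_map] at hx
      obtain ⟨x, -, rfl⟩ := hx
      obtain ⟨_ | ⟨b, q⟩, o⟩ := a <;>
        simp [addStep, eval, Datum.ofList, Datum.val_elem, enc, F]) (q, [])
  have hF : ∀ (p q o : List E),
      ((p.map Datum.elem).foldl (fun a x => F x a) (q, o)).2.reverse ++
        ((p.map Datum.elem).foldl (fun a x => F x a) (q, o)).1 = o.reverse ++ addList p q := by
    intro p
    induction p with
    | nil => simp [addList]
    | cons a p ih =>
      intro q o
      cases q with
      | nil => simpa [addList, Datum.val_elem, F] using ih [] (a :: o)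
      | cons b q => simpa [addList, Datum.val_elem, F] using ih q ((b + a) :: o)
  have hF0 := hF p q []
  rw [Datum.spine_ofList] at h
  simp only [enc, Datum.ofList] at h
  simp only [polyAdd, eval, Part.bind_some, h]
  rw [Datum.ofList_eq_seq, Datum.ofList_eq_seq]
  rw [eval_revAppend, Datum.ofList_eq_seq, Datum.spine_seq, ← List.map_reverse, ← List.map_append,
    hF0]
  simp

/-- Multiply two coefficient lists: on `(p, q)`. -/
def polyMul : Program :=
  .comp (foldr (.comp polyAdd (.pair (.comp scale (.pair (.comp .fst .snd) .fst))
    (.pair zero (.comp .snd .snd))))) (.pair .snd (.pair .fst .nil))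

/-- Horner's rule: `(a + X p) q = a q + X (p q)`, where multiplication by `X` puts a `0` in front of
the list. -/
theorem evalsToPoly_polyMul (p q : List E) :
    polyMul.EvalsToPoly (.pair (.ofList p) (.ofList q)) (polyOfList p * polyOfList q) := by
  have h := eval_foldr (E := E) Datum.ofList
    (f := .comp polyAdd (.pair (.comp scale (.pair (.comp .fst .snd) .fst))
      (.pair zero (.comp .snd .snd)))) (e := .ofList q)
    (F := fun x l => addList (q.map (x.val * ·)) (0 :: l)) (.ofList p)
    (fun x hx a => by
      rw [Datum.spine_ofList, List.mem_map] at hx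
      obtain ⟨x, -, rfl⟩ := hx
      have := eval_polyAdd (q.map (x * ·)) (0 :: a)
      simp only [Datum.ofList] at this
      simp [eval, eval_scale, this, Datum.val_elem]) []
  rw [Datum.ofList, Datum.spine_ofList] at h
  refine ⟨_, Eq.trans (by simp only [polyMul, eval, Part.bind_some]) h, ?_⟩
  clear h
  induction p with
  | nil => simp [polyOfList]
  | cons a p ih =>
    simp only [List.map_cons, List.foldr_cons, polyOfList_addList, polyOfList, polyOfList_scale, ih,
      Datum.val_elem, map_zero]
    ring

/-- The coefficient list of the derivative. -/
def polyDeriv : Program :=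
  .comp .snd (.comp (foldr (.pair (.pair (.comp .fst .snd) (.comp .fst (.comp .snd .snd)))
    (.comp polyAdd (.pair (.comp .fst (.comp .snd .snd))
      (.pair zero (.comp .snd (.comp .snd .snd)))))))
    (.pair .nil (.pair .id (.pair .nil .nil))))

/-- The recursion `(a + X p)' = p + X p'` needs the tail `p` as well as its derivative, so the fold
carries both. -/
theorem evalsToPoly_polyDeriv (p : List E) :
    polyDeriv.EvalsToPoly (.ofList p) (Polynomial.derivative (polyOfList p)) := by
  let enc : List E × List E → Datum E := fun a => .pair (.ofList a.1) (.ofList a.2)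
  let F : Datum E → List E × List E → List E × List E := fun x a =>
    (x.val :: a.1, addList a.1 (0 :: a.2))
  have h := eval_foldr (E := E) enc
    (f := .pair (.pair (.comp .fst .snd) (.comp .fst (.comp .snd .snd)))
      (.comp polyAdd (.pair (.comp .fst (.comp .snd .snd))
        (.pair zero (.comp .snd (.comp .snd .snd)))))) (e := .nil)
    (F := F) (.ofList p)
    (fun x hx a => by
      rw [Datum.spine_ofList, List.mem_map] at hx
      obtain ⟨x, -, rfl⟩ := hx
      have := eval_polyAdd a.1 (0 :: a.2)
      simp only [Datum.ofList] at this
      simp [eval, this, Datum.val_elem, enc, F, Datum.ofList]) ([], [])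
  rw [Datum.spine_ofList] at h
  simp only [enc, Datum.ofList] at h
  refine ⟨((p.map .elem).foldr F ([], [])).2,
    by simp only [polyDeriv, eval, Part.bind_some, h], ?_⟩
  clear h
  have hF : (fun a : List E × List E => a.1 = p ∧
      polyOfList a.2 = Polynomial.derivative (polyOfList p))
      ((p.map Datum.elem).foldr F ([], [])) := by
    induction p with
    | nil => simp [polyOfList]
    | cons a p ih =>
      simp only [List.map_cons, List.foldr_cons] at ih ⊢
      obtain ⟨h1, h2⟩ := ih
      constructor
      · simp [F, h1, Datum.val_elem]
      · simp only [F, polyOfList_addList, h1, polyOfList, h2]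
        simp
  exact hF.2

/-- The coefficient list of the power of the variable whose exponent is the length of the list. -/
def monomial : Program :=
  .comp (foldr (.pair zero (.comp .snd .snd))) (.pair .nil (.pair .id (.pair .one .nil)))

theorem evalsToPoly_monomial (p : List E) :
    monomial.EvalsToPoly (.ofList p) (Polynomial.X ^ p.length) := by
  have h := eval_foldr (E := E) Datum.ofList (f := .pair zero (.comp .snd .snd)) (e := .nil)
    (F := fun _ l => 0 :: l) (.ofList p)
    (fun x hx a => by simp [eval, Datum.ofList]) [1]
  rw [Datum.spine_ofList] at h
  simp only [Datum.ofList] at h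
  refine ⟨_, Eq.trans (by simp only [monomial, eval, Part.bind_some]) h, ?_⟩
  clear h
  induction p with
  | nil => simp [polyOfList]
  | cons a p ih =>
    simp only [List.map_cons, List.foldr_cons, polyOfList, ih, List.length_cons]
    simp; ring

theorem polyOfList_eq_zero_iff (p : List E) : polyOfList p = 0 ↔ ∀ a ∈ p, a = 0 := by
  induction p with
  | nil => simp [polyOfList]
  | cons a p ih =>
    rw [List.forall_mem_cons, ← ih, polyOfList]
    constructor
    · intro h
      have h0 : a = 0 := by simpa using congrArg (Polynomial.coeff · 0) h
      subst h0
      simpa using h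
    · rintro ⟨rfl, h⟩
      simp [h]

/-- Test whether a coefficient list is that of the polynomial `0`. -/
def polyIsZero : Program :=
  .comp (fold (.cond (.comp .isZero (.comp .fst .snd)) (.comp .snd .snd) .nil))
    (.pair .nil (.pair .id (.pair .nil .nil)))

theorem eval_polyIsZero (p : List E) :
    polyIsZero.eval (.ofList p) = Part.some (ofProp (polyOfList p = 0)) := by
  have h := eval_fold (E := E) ofProp
    (f := .cond (.comp .isZero (.comp .fst .snd)) (.comp .snd .snd) .nil) (e := .nil)
    (F := fun x P => x.val = 0 ∧ P) (.ofList p)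
    (fun x hx a => by
      rw [Datum.spine_ofList, List.mem_map] at hx
      obtain ⟨x, -, rfl⟩ := hx
      by_cases hx : x = 0 <;> by_cases ha : a <;>
        simp [eval, Datum.val_elem, hx, ha, ofProp, Datum.tt]) True
  rw [Datum.spine_ofList] at h
  have key : ∀ (p : List E) (P : Prop),
      (p.map Datum.elem).foldl (fun P x => x.val = 0 ∧ P) P ↔ (P ∧ ∀ a ∈ p, a = 0) := by
    intro p
    induction p with
    | nil => simp
    | cons a p ih =>
      intro P
      rw [List.map_cons, List.foldl_cons, ih, List.forall_mem_cons]
      exact ⟨fun h => ⟨h.1.2, h.1.1, h.2⟩, fun h => ⟨⟨h.2.1, h.1⟩, h.2.2⟩⟩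
  rw [key p True, true_and, ← polyOfList_eq_zero_iff] at h
  rw [← h]
  simp only [polyIsZero, eval, Part.bind_some, ofProp, Datum.tt, if_true]

end Program

/-! ### Polynomial terms and tests -/

/-- Polynomial expressions over a list of coefficient lists. -/
inductive PolyTerm where
  | var (i : ℕ) : PolyTerm
  | mono (i : ℕ) : PolyTerm
  | one : PolyTerm
  | indet : PolyTerm
  | add (s t : PolyTerm) : PolyTerm
  | mul (s t : PolyTerm) : PolyTerm
  | neg (t : PolyTerm) : PolyTerm
  | deriv (t : PolyTerm) : PolyTerm

/-- Boolean combinations of polynomial identities, together with the test that `a + n b ≠ 0` for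
all natural numbers `n`, where `a` and `b` are the constant terms of two variables. -/
inductive Test where
  | isZero (t : PolyTerm) : Test
  | notNat (i j : ℕ) : Test
  | and (s t : Test) : Test
  | or (s t : Test) : Test

namespace PolyTerm

/-- The value of a polynomial expression; `mono i` is the power of the variable whose exponent is
the length of the `i`-th list. -/
noncomputable def denote {E : Type u} [Field E] (L : List (List E)) : PolyTerm → E[X]
  | var i => polyOfList (L.getD i [])
  | mono i => Polynomial.X ^ (L.getD i []).length
  | one => 1
  | indet => Polynomial.X
  | add s t => s.denote L + t.denote L
  | mul s t => s.denote L * t.denote L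
  | neg t => -t.denote L
  | deriv t => Polynomial.derivative (t.denote L)

end PolyTerm

/-- The truth value of a test. -/
def Test.Holds {E : Type u} [Field E] (L : List (List E)) : Test → Prop
  | isZero t => t.denote L = 0
  | notNat i j => ∀ n : ℕ, (L.getD i []).headD 0 + n * (L.getD j []).headD 0 ≠ 0
  | and s t => s.Holds L ∧ t.Holds L
  | or s t => s.Holds L ∨ t.Holds L

/-! ### Transfer of terms and tests along field embeddings -/

section Map

universe v

variable {F : Type u} {E : Type v} [Field F] [Field E]

theorem polyOfList_map (φ : F →+* E) (l : List F) :
    polyOfList (l.map φ) = (polyOfList l).map φ := by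
  induction l with
  | nil => simp [polyOfList]
  | cons a l ih => simp [polyOfList, ih]

theorem PolyTerm.denote_map (φ : F →+* E) (L : List (List F)) (t : PolyTerm) :
    t.denote (L.map (List.map φ)) = (t.denote L).map φ := by
  have h : ∀ i, (L.map (List.map φ)).getD i [] = (L.getD i []).map φ := by
    intro i
    simp only [List.getD_eq_getElem?_getD, List.getElem?_map]
    cases L[i]? <;> simp
  induction t with
  | var i => rw [denote, denote, h, polyOfList_map]
  | mono i => rw [denote, denote, h]; simp
  | one => simp [denote]
  | indet => simp [denote]
  | add s t hs ht => simp [denote, hs, ht]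
  | mul s t hs ht => simp [denote, hs, ht]
  | neg t ht => simp [denote, ht]
  | deriv t ht => simp [denote, ht, Polynomial.derivative_map]

/-- Identities are preserved by every ring homomorphism, and the inequalities `a + n b ≠ 0` by
injectivity of a homomorphism of fields. This carries a certificate found over a subfield to the
whole field. -/
theorem Test.Holds.map (φ : F →+* E) {L : List (List F)} {t : Test} (h : t.Holds L) :
    t.Holds (L.map (List.map φ)) := by
  have hL : ∀ i, ((L.map (List.map φ)).getD i []).headD 0 = φ ((L.getD i []).headD 0) := by
    intro i
    simp only [List.getD_eq_getElem?_getD, List.getElem?_map]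
    cases L[i]? with
    | none => simp
    | some l => cases l <;> simp
  induction t with
  | isZero t => simpa [Holds, PolyTerm.denote_map] using congrArg (Polynomial.map φ) h
  | notNat i j =>
    intro n hn
    rw [hL, hL] at hn
    apply h n
    apply φ.injective
    simpa using hn
  | and s t hs ht => exact ⟨hs h.1, ht h.2⟩
  | or s t hs ht => exact h.imp hs ht

end Map

/-! ### Translation of terms and tests into programs -/

namespace Program

variable {E : Type u} [Field E]

/-- Take the `i`-th entry of a list. -/
def nth : ℕ → Program
  | 0 => .fst
  | i + 1 => .comp (nth i) .snd

theorem eval_nth (L : List (List E)) (i : ℕ) :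
    (nth i).eval (.ofLists L) = Part.some (.ofList (L.getD i [])) := by
  induction i generalizing L with
  | zero => cases L <;> simp [nth, eval, Datum.ofLists, Datum.seq, Datum.ofList]
  | succ i ih =>
    cases L with
    | nil =>
      have := ih []
      simp only [Datum.ofLists, Datum.seq, List.map_nil] at this
      simp [nth, eval, Datum.ofLists, Datum.seq, this]
    | cons l L =>
      have := ih L
      simp only [Datum.ofLists] at this
      simp [nth, eval, Datum.ofLists, Datum.seq, this]

/-- The program computes a coefficient list of the value of a polynomial expression. -/
def ofPolyTerm : PolyTerm → Program
  | .var i => nth i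
  | .mono i => .comp monomial (nth i)
  | .one => .pair .one .nil
  | .indet => .pair zero (.pair .one .nil)
  | .add s t => .comp polyAdd (.pair (ofPolyTerm s) (ofPolyTerm t))
  | .mul s t => .comp polyMul (.pair (ofPolyTerm s) (ofPolyTerm t))
  | .neg t => .comp scale (.pair (.comp .neg .one) (ofPolyTerm t))
  | .deriv t => .comp polyDeriv (ofPolyTerm t)

theorem evalsToPoly_ofPolyTerm (L : List (List E)) (t : PolyTerm) :
    (ofPolyTerm t).EvalsToPoly (.ofLists L) (t.denote L) := by
  induction t with
  | var i => exact ⟨_, eval_nth L i, rfl⟩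
  | mono i =>
    obtain ⟨l, hl, hl'⟩ := evalsToPoly_monomial (L.getD i [])
    exact ⟨l, by rw [ofPolyTerm, eval_comp_of (eval_nth L i), hl], hl'⟩
  | one => exact ⟨[1], by simp [ofPolyTerm, eval, Datum.ofList],
      by simp [polyOfList, PolyTerm.denote]⟩
  | indet => exact ⟨[0, 1], by simp [ofPolyTerm, eval, Datum.ofList],
      by simp [polyOfList, PolyTerm.denote]⟩
  | add s t hs ht =>
    obtain ⟨p, hp, hp'⟩ := hs
    obtain ⟨q, hq, hq'⟩ := ht
    exact ⟨addList p q, by simp [ofPolyTerm, eval, hp, hq, eval_polyAdd],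
      by rw [polyOfList_addList, hp', hq', PolyTerm.denote]⟩
  | mul s t hs ht =>
    obtain ⟨p, hp, hp'⟩ := hs
    obtain ⟨q, hq, hq'⟩ := ht
    obtain ⟨r, hr, hr'⟩ := evalsToPoly_polyMul p q
    exact ⟨r, by simp [ofPolyTerm, eval, hp, hq, hr], by rw [hr', hp', hq', PolyTerm.denote]⟩
  | neg t ht =>
    obtain ⟨p, hp, hp'⟩ := ht
    exact ⟨p.map (-1 * ·), by simp [ofPolyTerm, eval, hp, eval_scale],
      by rw [polyOfList_scale, hp', PolyTerm.denote]; simp⟩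
  | deriv t ht =>
    obtain ⟨p, hp, hp'⟩ := ht
    obtain ⟨r, hr, hr'⟩ := evalsToPoly_polyDeriv p
    exact ⟨r, by simp [ofPolyTerm, eval, hp, hr], by rw [hr', hp', PolyTerm.denote]⟩

/-- The constant term of the `i`-th list. -/
def constTerm (i : ℕ) : Program :=
  .comp val (.comp .fst (nth i))

theorem eval_constTerm (L : List (List E)) (i : ℕ) :
    (constTerm i).eval (.ofLists L) = Part.some (.elem ((L.getD i []).headD 0)) := by
  have h := eval_nth L i
  cases hl : L.getD i [] with
  | nil =>
    rw [hl, Datum.ofList] at h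
    simp [constTerm, eval, h, Datum.val]
  | cons a l =>
    rw [hl, Datum.ofList] at h
    simp [constTerm, eval, h, Datum.val]

/-- The program that runs a test. -/
def ofTest : Test → Program
  | .isZero t => .comp polyIsZero (ofPolyTerm t)
  | .notNat i j => .cond (.cond (.comp .isZero (constTerm j)) (.comp .isZero (constTerm i))
      (.comp .isNat (.comp .neg (.comp .mul (.pair (constTerm i) (.comp .inv (constTerm j)))))))
      .nil (.pair .nil .nil)
  | .and s t => .cond (ofTest s) (ofTest t) .nil
  | .or s t => .cond (ofTest s) (.pair .nil .nil) (ofTest t)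

theorem eval_ofTest (L : List (List E)) (t : Test) :
    (ofTest t).eval (.ofLists L) = Part.some (ofProp (t.Holds L)) := by
  induction t with
  | isZero t =>
    obtain ⟨p, hp, hp'⟩ := evalsToPoly_ofPolyTerm L t
    rw [ofTest, eval_comp_of hp, eval_polyIsZero, hp', Test.Holds]
  | notNat i j =>
    have hi := eval_constTerm L i
    have hj := eval_constTerm L j
    rw [Test.Holds]
    set a := (L.getD i []).headD 0
    set b := (L.getD j []).headD 0
    -- For `b ≠ 0` the only candidate for `n` is `-a / b`, so one test for natural numbers decides
    -- all inequalities; for `b = 0` they all say `a ≠ 0`.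
    by_cases hb : b = 0
    · by_cases ha : a = 0
      · rw [ofProp_of_not (by simp [ha, hb])]
        simp [ofTest, eval, hi, hj, ha, hb, Datum.tt]
      · rw [ofProp_of (by simp [ha, hb])]
        simp [ofTest, eval, hi, hj, ha, hb, Datum.tt]
    · by_cases hn : ∃ n : ℕ, -(a * b⁻¹) = n
      · have hn' := hn
        obtain ⟨n, hn⟩ := hn
        rw [ofProp_of_not (fun h => h n (by rw [← hn]; field_simp; ring))]
        simp [ofTest, eval, hi, hj, hb, Datum.tt, hn']
      · rw [ofProp_of (fun n h => hn ⟨n, by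
          rw [eq_neg_of_add_eq_zero_left h]; field_simp⟩)]
        simp [ofTest, eval, hi, hj, hb, Datum.tt, hn]
  | and s t hs ht =>
    by_cases h : s.Holds L <;> by_cases h' : t.Holds L <;>
      simp [ofTest, eval, hs, ht, h, h', Test.Holds, ofProp, Datum.tt]
  | or s t hs ht =>
    by_cases h : s.Holds L <;> by_cases h' : t.Holds L <;>
      simp [ofTest, eval, hs, ht, h, h', Test.Holds, ofProp, Datum.tt]

/-! ### Exhaustive search -/

section Search

/-- Run all instructions on the first configuration of the queue, and put the results in front of
the second list: on `(input, (queue, results))`. -/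
def pushAll : List Program → Program
  | [] => .comp .snd .snd
  | i :: is => .pair (.comp i (.pair .fst (.comp .fst (.comp .fst .snd)))) (pushAll is)

/-- One step of the search: if the queue is not empty, replace its first configuration by the
results of all instructions on it, put on the waiting list; otherwise the waiting list becomes the
queue. -/
def searchStep (is : List Program) : Program :=
  .cond (.comp .fst .snd)
    (.pair .fst (.pair (.comp .snd (.comp .fst .snd)) (pushAll is)))
    (.pair .fst (.pair (.comp .snd .snd) .nil))

/-- Test whether the queue is empty or its first configuration does not meet the goal. -/
def searchTest (goal : Program) : Program :=
  .cond (.comp .fst .snd)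
    (.cond (.comp goal (.pair .fst (.comp .fst (.comp .fst .snd)))) .nil (.pair .nil .nil))
    (.pair .nil .nil)

/-- Search all configurations that arise from the queue by instructions, until one of them meets
the goal. -/
def search (is : List Program) (goal : Program) : Program :=
  .loop (searchTest goal) (searchStep is)

/-- One of the instructions leads from `s` to `s'` on the given input. -/
def Step (is : List Program) (input s s' : Datum E) : Prop :=
  ∃ i ∈ is, i.eval (.pair input s) = Part.some s'

theorem eval_pushAll {is : List Program} {input s : Datum E}
    (his : ∀ i ∈ is, ∃ s', i.eval (.pair input s) = Part.some s') (Q W : List (Datum E)) :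
    ∃ l, (pushAll is).eval (.pair input (.pair (.seq (s :: Q)) (.seq W))) =
      Part.some (.seq (l ++ W)) ∧ ∀ s', Step is input s s' → s' ∈ l := by
  induction is with
  | nil => exact ⟨[], by simp [pushAll, eval], by simp [Step]⟩
  | cons i is ih =>
    obtain ⟨l, hl, hl'⟩ := ih fun i hi => his i (by simp [hi])
    obtain ⟨s', hs'⟩ := his i (by simp)
    refine ⟨s' :: l, ?_, ?_⟩
    · rw [Datum.seq] at hl
      simp [pushAll, eval, hl, Datum.seq, hs']
    · rintro t ⟨j, hj, ht⟩
      rcases List.mem_cons.1 hj with rfl | hj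
      · rw [hs', Part.some_inj] at ht
        simp [ht]
      · exact List.mem_cons_of_mem _ (hl' t ⟨j, hj, ht⟩)

/-- The search is fair: the queue is used up before the waiting list replaces it, so configurations
are visited level by level. Since instructions and goal test halt everywhere, each reachable
configuration is met unless the search stops earlier, at some `r` that need not be `t`. -/
theorem eval_search {is : List Program} {goal : Program} {input : Datum E} {G : Datum E → Prop}
    (his : ∀ i ∈ is, ∀ s, ∃ s', i.eval (.pair input s) = Part.some s')
    (hgoal : ∀ s, goal.eval (.pair input s) = Part.some (ofProp (G s))) {s t : Datum E}
    (hst : Relation.ReflTransGen (Step is input) s t) (ht : G t) :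
    ∃ r Q W, G r ∧ (search is goal).eval (.pair input (.pair (.seq [s]) .nil)) =
      Part.some (.pair input (.pair (.pair r Q) W)) := by
  let Halts (Q W : List (Datum E)) : Prop := ∃ r Q' W', G r ∧
    (search is goal).eval (.pair input (.pair (.seq Q) (.seq W))) =
      Part.some (.pair input (.pair (.pair r Q') W'))
  have halts_goal : ∀ r Q W, G r → Halts (r :: Q) W := by
    intro r Q W hr
    refine ⟨r, .seq Q, .seq W, hr, ?_⟩
    rw [search, eval_loop_of_nil]
    · rfl
    · simp [searchTest, eval, hgoal, Datum.seq, ofProp_of hr]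
  have halts_nil : ∀ W, Halts W [] → Halts [] W := by
    rintro W ⟨r, Q', W', hr, h⟩
    refine ⟨r, Q', W', hr, ?_⟩
    rw [← h, search]
    apply eval_loop_of_ne (t := .pair .nil .nil)
    · simp [searchTest, eval, Datum.seq]
    · simp
    · simp [searchStep, eval, Datum.seq]
  have halts_cons : ∀ s Q W, ¬G s →
      ∃ l, (∀ s', Step is input s s' → s' ∈ l) ∧ (Halts Q (l ++ W) → Halts (s :: Q) W) := by
    intro s Q W hs
    obtain ⟨l, hl, hl'⟩ := eval_pushAll (is := is) (fun i hi => his i hi s) Q W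
    refine ⟨l, hl', ?_⟩
    rintro ⟨r, Q', W', hr, h⟩
    refine ⟨r, Q', W', hr, ?_⟩
    rw [← h, search]
    apply eval_loop_of_ne (t := .pair .nil .nil)
    · simp [searchTest, eval, Datum.seq, hgoal, ofProp_of_not hs]
    · simp
    · rw [Datum.seq] at hl ⊢
      simp [searchStep, eval, hl]
  -- By induction on the queue: unless a goal is met first, the queue runs empty and the waiting
  -- list takes its place. New results only enlarge the waiting list, so the entry in question is
  -- not lost.
  have wait : ∀ P : Datum E → Prop, (∀ Q W, (∃ s ∈ Q, P s) → Halts Q W) →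
      ∀ Q W, (∃ s ∈ W, P s) → Halts Q W := by
    intro P hP Q
    induction Q with
    | nil => exact fun W hW => halts_nil W (hP W [] hW)
    | cons s Q ih =>
      rintro W ⟨t, ht, htP⟩
      by_cases hs : G s
      · exact halts_goal _ _ _ hs
      · obtain ⟨l, -, hl⟩ := halts_cons s Q W hs
        exact hl (ih _ ⟨t, by simp [ht], htP⟩)
  -- The outer induction runs backwards along the path from `s` to `t`, the inner one over the
  -- entries of the queue in front of the given configuration.
  have main : ∀ Q W, (∃ s' ∈ Q, s' = s) → Halts Q W := by
    induction hst using Relation.ReflTransGen.head_induction_on with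
    | refl =>
      intro Q
      induction Q with
      | nil => simp
      | cons a Q ih =>
        rintro W ⟨s', hs', rfl⟩
        by_cases ha : G a
        · exact halts_goal _ _ _ ha
        · rcases List.mem_cons.1 hs' with rfl | hs'
          · exact absurd ht ha
          · obtain ⟨l, -, hl⟩ := halts_cons a Q W ha
            exact hl (ih _ ⟨s', hs', rfl⟩)
    | @head b c hbc _ ih' =>
      intro Q
      induction Q with
      | nil => simp
      | cons a Q ih =>
        rintro W ⟨s', hs', rfl⟩
        by_cases ha : G a
        · exact halts_goal _ _ _ ha
        · obtain ⟨l, hl', hl⟩ := halts_cons a Q W ha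
          rcases List.mem_cons.1 hs' with rfl | hs'
          · exact hl (wait (· = c) ih' _ _ ⟨c, by simp [hl' c hbc], rfl⟩)
          · exact hl (ih _ ⟨s', hs', rfl⟩)
  obtain ⟨r, Q, W, hr, h⟩ := main [s] [] ⟨s, by simp, rfl⟩
  exact ⟨r, Q, W, hr, h⟩

end Search

/-! ### A stack machine that builds all trees over the field generated by the input -/

/-- Replace the top entry of the stack: on `(input, stack)`. -/
def onTop (u : Program) : Program :=
  .pair (.comp u (.comp .fst .snd)) (.comp .snd .snd)

/-- Replace the top two entries of the stack by one: on `(input, stack)`. -/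
def onTopTwo (u : Program) : Program :=
  .pair (.comp u (.pair (.comp .fst .snd) (.comp .fst (.comp .snd .snd))))
    (.comp .snd (.comp .snd .snd))

/-- The instructions of the stack machine. -/
def instructions : List Program :=
  [.pair .nil .snd, .pair .one .snd, .pair .fst .snd, onTop .fst, onTop .snd, onTop .neg,
    onTop .inv, onTopTwo .add, onTopTwo .mul, onTopTwo .id]

/-- Totality matters: one diverging instruction would block the whole search. -/
theorem exists_eval_instructions (input : Datum E) :
    ∀ i ∈ instructions, ∀ s, ∃ s', i.eval (.pair input s) = Part.some s' := by
  have h1 : ∀ u : Program, (∀ d : Datum E, ∃ d', u.eval d = Part.some d') → ∀ s : Datum E,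
      ∃ s', (onTop u).eval (.pair input s) = Part.some s' := by
    intro u hu s
    rcases s with _ | _ | ⟨a, s⟩
    · obtain ⟨d, hd⟩ := hu .nil
      exact ⟨_, by simp [onTop, eval, hd]; rfl⟩
    · obtain ⟨d, hd⟩ := hu .nil
      exact ⟨_, by simp [onTop, eval, hd]; rfl⟩
    · obtain ⟨d, hd⟩ := hu a
      exact ⟨_, by simp [onTop, eval, hd]; rfl⟩
  have h2 : ∀ u : Program, (∀ d : Datum E, ∃ d', u.eval d = Part.some d') → ∀ s : Datum E,
      ∃ s', (onTopTwo u).eval (.pair input s) = Part.some s' := by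
    intro u hu s
    have hfst : ∀ d : Datum E, ∃ d', Program.fst.eval d = Part.some d' := by
      rintro (_ | _ | _) <;> exact ⟨_, rfl⟩
    have hsnd : ∀ d : Datum E, ∃ d', Program.snd.eval d = Part.some d' := by
      rintro (_ | _ | _) <;> exact ⟨_, rfl⟩
    obtain ⟨a, ha⟩ := hfst s
    obtain ⟨r, hr⟩ := hsnd s
    obtain ⟨b, hb⟩ := hfst r
    obtain ⟨t, ht⟩ := hsnd r
    obtain ⟨c, hc⟩ := hu (.pair a b)
    have hs : Program.snd.eval (.pair input s) = Part.some s := rfl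
    have hs2 := (eval_comp_of (g := .snd) hs).trans hr
    exact ⟨_, eval_pair_of ((eval_comp_of (eval_pair_of ((eval_comp_of hs).trans ha)
      ((eval_comp_of hs2).trans hb))).trans hc) ((eval_comp_of hs2).trans ht)⟩
  intro i hi
  simp only [instructions, List.mem_cons, List.not_mem_nil, or_false] at hi
  rcases hi with rfl | rfl | rfl | rfl | rfl | rfl | rfl | rfl | rfl | rfl
  · exact fun s => ⟨_, by simp [eval]; rfl⟩
  · exact fun s => ⟨_, by simp [eval]; rfl⟩
  · exact fun s => ⟨_, by simp [eval]; rfl⟩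
  · exact h1 _ (by rintro (_ | _ | _) <;> exact ⟨_, rfl⟩)
  · exact h1 _ (by rintro (_ | _ | _) <;> exact ⟨_, rfl⟩)
  · exact h1 _ (by rintro (_ | _ | _) <;> exact ⟨_, rfl⟩)
  · exact h1 _ (by rintro (_ | _ | _) <;> exact ⟨_, rfl⟩)
  · exact h2 _ (by rintro (_ | _ | ⟨_ | _ | _, _ | _ | _⟩) <;> exact ⟨_, rfl⟩)
  · exact h2 _ (by rintro (_ | _ | ⟨_ | _ | _, _ | _ | _⟩) <;> exact ⟨_, rfl⟩)
  · exact h2 _ (fun d => ⟨d, rfl⟩)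

end Program

/-- The field elements on the leaves of a tree. -/
def Datum.leaves {E : Type u} : Datum E → Set E
  | .nil => ∅
  | .elem x => {x}
  | .pair a b => a.leaves ∪ b.leaves

namespace Program

variable {E : Type u} [Field E]

theorem reflTransGen_step_elem_of_mem_leaves {input d : Datum E} {x : E} (hx : x ∈ d.leaves)
    (s : Datum E) :
    Relation.ReflTransGen (Step instructions input) (.pair d s) (.pair (.elem x) s) := by
  induction d with
  | nil => exact absurd hx (by simp [Datum.leaves])
  | elem y =>
    rw [Datum.leaves, Set.mem_singleton_iff] at hx
    rw [hx]
  | pair a b ha hb =>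
    rcases hx with hx | hx
    · exact .head ⟨onTop .fst, by simp [instructions], by simp [onTop, eval]⟩ (ha hx)
    · exact .head ⟨onTop .snd, by simp [instructions], by simp [onTop, eval]⟩ (hb hx)

/-- The stack machine follows the construction of `x` in the generated subfield: a generator is
reached by pushing the input and descending to a leaf, and each field operation acts on top of the
stack, leaving `s` untouched. -/
theorem reflTransGen_step_elem {input : Datum E} {x : E}
    (hx : x ∈ Subfield.closure input.leaves) (s : Datum E) :
    Relation.ReflTransGen (Step instructions input) s (.pair (.elem x) s) := by
  induction hx using Subfield.closure_induction generalizing s with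
  | mem x hx =>
    exact .head ⟨.pair .fst .snd, by simp [instructions], by simp [eval]⟩
      (reflTransGen_step_elem_of_mem_leaves hx s)
  | one => exact .single ⟨.pair .one .snd, by simp [instructions], by simp [eval]⟩
  | add x y _ _ hx hy =>
    exact ((hy s).trans (hx _)).tail
      ⟨onTopTwo .add, by simp [instructions], by simp [onTopTwo, eval]⟩
  | neg x _ hx =>
    exact (hx s).tail ⟨onTop .neg, by simp [instructions], by simp [onTop, eval]⟩
  | inv x _ hx =>
    exact (hx s).tail ⟨onTop .inv, by simp [instructions], by simp [onTop, eval]⟩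
  | mul x y _ _ hx hy =>
    exact ((hy s).trans (hx _)).tail
      ⟨onTopTwo .mul, by simp [instructions], by simp [onTopTwo, eval]⟩

theorem reflTransGen_step {input d : Datum E}
    (hd : d.leaves ⊆ Subfield.closure input.leaves) (s : Datum E) :
    Relation.ReflTransGen (Step instructions input) s (.pair d s) := by
  induction d generalizing s with
  | nil => exact .single ⟨.pair .nil .snd, by simp [instructions], by simp [eval]⟩
  | elem x => exact reflTransGen_step_elem (hd (by simp [Datum.leaves])) s
  | pair a b ha hb =>
    rw [Datum.leaves, Set.union_subset_iff] at hd
    exact ((hb hd.2 s).trans (ha hd.1 _)).tail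
      ⟨onTopTwo .id, by simp [instructions], by simp [onTopTwo, eval]⟩

end Program

namespace Datum

variable {E : Type u}

theorem leaves_seq (l : List (Datum E)) : (seq l).leaves = {x | ∃ d ∈ l, x ∈ d.leaves} := by
  induction l with
  | nil => simp [seq, leaves]
  | cons a l ih => ext x; simp [seq, leaves, ih]

theorem leaves_ofList (l : List E) : (ofList l).leaves = {x | x ∈ l} := by
  rw [ofList_eq_seq, leaves_seq]
  ext x
  simp [leaves]

theorem leaves_ofLists (L : List (List E)) : (ofLists L).leaves = {x | ∃ l ∈ L, x ∈ l} := by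
  rw [ofLists, leaves_seq]
  ext x
  simp [leaves_ofList]

end Datum

/-! ### The search for a certificate of the input -/

namespace Program

/-- The list of polynomials that consists of those of the input and of a candidate for the
certificate, which is the top entry of the stack: on `(input, stack)`. -/
def candidate : Program :=
  .pair (.comp .fst (.comp .fst .fst)) (.pair (.comp .snd (.comp .fst .fst))
    (.pair (.comp .fst (.comp .snd .fst)) (.pair (.comp .snd (.comp .snd .fst))
      (.comp toLists (.comp .fst .snd)))))

/-- Search for a certificate that passes a test, and give as result the fractions `n₁ / d₁` and
`n₂ / d₂`. -/
def certificateSearch (t : Test) (n₁ d₁ n₂ d₂ : PolyTerm) : Program :=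
  .comp (.pair (.pair (ofPolyTerm n₁) (ofPolyTerm d₁)) (.pair (ofPolyTerm n₂) (ofPolyTerm d₂)))
    (.comp candidate
      (.comp (.pair .fst (.comp .fst (.comp .fst .snd)))
        (.comp (search instructions (.comp (ofTest t) candidate))
          (.pair .id (.pair (.pair .nil .nil) .nil)))))

variable {E : Type u} [Field E]

/-- Every stack, even a malformed one, is read as some list of coefficient lists. Hence the goal
test of the search is total. -/
theorem eval_candidate (p₁ p₂ p₃ p₄ : List E) (s : Datum E) :
    ∃ L, candidate.eval (.pair (.pair (.pair (.ofList p₁) (.ofList p₂))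
      (.pair (.ofList p₃) (.ofList p₄))) s) = Part.some (.ofLists (p₁ :: p₂ :: p₃ :: p₄ :: L)) ∧
      ∀ d s', s = .pair d s' → L = d.toLists := by
  have key : ∀ d : Datum E, Program.fst.eval s = Part.some d →
      candidate.eval (.pair (.pair (.pair (.ofList p₁) (.ofList p₂))
        (.pair (.ofList p₃) (.ofList p₄))) s) =
          Part.some (.ofLists (p₁ :: p₂ :: p₃ :: p₄ :: d.toLists)) := by
    intro d hd
    have h1 : (Program.comp .fst .snd).eval (.pair (.pair (.pair (.ofList p₁) (.ofList p₂))
        (.pair (.ofList p₃) (.ofList p₄))) s) = Part.some d := by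
      rw [← hd]
      exact eval_comp_of rfl
    have h2 := eval_toLists d
    have h3 : (Program.comp toLists (.comp .fst .snd)).eval (.pair (.pair (.pair (.ofList p₁)
        (.ofList p₂)) (.pair (.ofList p₃) (.ofList p₄))) s) = Part.some (.ofLists d.toLists) := by
      rw [eval_comp_of h1, h2]
    generalize hP : Program.comp toLists (.comp .fst .snd) = P at h3
    simp [candidate, hP, eval, h3, Datum.ofLists, Datum.seq]
  rcases s with _ | x | ⟨d, s⟩
  · exact ⟨_, key .nil rfl, by simp⟩
  · exact ⟨_, key .nil rfl, by simp⟩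
  · refine ⟨_, key d rfl, ?_⟩
    rintro d' s' h
    cases h
    rfl

theorem eval_certificateSearch {t : Test} {p₁ p₂ p₃ p₄ : List E} {C : List (List E)}
    (hC : ∀ l ∈ C, ∀ x ∈ l,
      x ∈ Subfield.closure {y : E | y ∈ p₁ ∨ y ∈ p₂ ∨ y ∈ p₃ ∨ y ∈ p₄})
    (ht : t.Holds (p₁ :: p₂ :: p₃ :: p₄ :: C)) (n₁ d₁ n₂ d₂ : PolyTerm) :
    ∃ L, t.Holds (p₁ :: p₂ :: p₃ :: p₄ :: L) ∧ ∃ a b c d : List E,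
      (certificateSearch t n₁ d₁ n₂ d₂).eval (.pair (.pair (.ofList p₁) (.ofList p₂))
        (.pair (.ofList p₃) (.ofList p₄))) =
        Part.some (.pair (.pair (.ofList a) (.ofList b)) (.pair (.ofList c) (.ofList d))) ∧
      polyOfList a = n₁.denote (p₁ :: p₂ :: p₃ :: p₄ :: L) ∧
      polyOfList b = d₁.denote (p₁ :: p₂ :: p₃ :: p₄ :: L) ∧
      polyOfList c = n₂.denote (p₁ :: p₂ :: p₃ :: p₄ :: L) ∧
      polyOfList d = d₂.denote (p₁ :: p₂ :: p₃ :: p₄ :: L) := by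
  choose L hL hL' using eval_candidate p₁ p₂ p₃ p₄
  set input : Datum E := .pair (.pair (.ofList p₁) (.ofList p₂))
    (.pair (.ofList p₃) (.ofList p₄)) with hinput
  have hgoal : ∀ s, (Program.comp (ofTest t) candidate).eval (.pair input s) =
      Part.some (ofProp (t.Holds (p₁ :: p₂ :: p₃ :: p₄ :: L s))) := by
    intro s
    rw [eval_comp_of (hL s), eval_ofTest]
  -- This is what makes the tree of `C` reachable: its leaves lie in the subfield generated by the
  -- leaves of the input.
  have hleaves : (Datum.ofLists C).leaves ⊆ Subfield.closure input.leaves := by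
    have : input.leaves = {y : E | y ∈ p₁ ∨ y ∈ p₂ ∨ y ∈ p₃ ∨ y ∈ p₄} := by
      ext y
      simp [hinput, Datum.leaves, Datum.leaves_ofList, or_assoc]
    rw [this, Datum.leaves_ofLists]
    rintro x ⟨l, hl, hx⟩
    exact hC l hl x hx
  obtain ⟨r, Q, W, hr, h⟩ := eval_search (exists_eval_instructions input) hgoal
    (reflTransGen_step hleaves .nil) (by
      rw [hL' _ _ _ rfl, Datum.toLists_ofLists]
      exact ht)
  refine ⟨L r, hr, ?_⟩
  obtain ⟨a, ha, ha'⟩ := evalsToPoly_ofPolyTerm (p₁ :: p₂ :: p₃ :: p₄ :: L r) n₁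
  obtain ⟨b, hb, hb'⟩ := evalsToPoly_ofPolyTerm (p₁ :: p₂ :: p₃ :: p₄ :: L r) d₁
  obtain ⟨c, hc, hc'⟩ := evalsToPoly_ofPolyTerm (p₁ :: p₂ :: p₃ :: p₄ :: L r) n₂
  obtain ⟨d, hd, hd'⟩ := evalsToPoly_ofPolyTerm (p₁ :: p₂ :: p₃ :: p₄ :: L r) d₂
  refine ⟨a, b, c, d, ?_, ha', hb', hc', hd'⟩
  have h0 : (Program.pair .id (.pair (.pair .nil .nil) .nil)).eval input =
      Part.some (.pair input (.pair (.seq [.nil]) .nil)) := by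
    simp [eval, Datum.seq]
  have h1 : (Program.pair .fst (.comp .fst (.comp .fst .snd))).eval
      (.pair input (.pair (.pair r Q) W)) = Part.some (.pair input r) := by
    simp [eval]
  have h2 := (eval_comp_of (g := search instructions (.comp (ofTest t) candidate)) h0).trans h
  rw [certificateSearch, eval_comp_of ((eval_comp_of ((eval_comp_of h2).trans h1)).trans (hL r))]
  exact eval_pair_of (eval_pair_of ha hb) (eval_pair_of hc hd)

end Program

open Polynomial

/-! ### Uniqueness of residual forms -/

section Uniqueness

variable {E : Type u} [Field E]

theorem ratFunc_deriv_div (p : E[X]) {q : E[X]} (hq : q ≠ 0) :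
    (algebraMap E[X] (RatFunc E) p / algebraMap E[X] (RatFunc E) q)′ =
      (algebraMap E[X] (RatFunc E) (derivative p) * algebraMap E[X] (RatFunc E) q -
        algebraMap E[X] (RatFunc E) p * algebraMap E[X] (RatFunc E) (derivative q)) /
        algebraMap E[X] (RatFunc E) q ^ 2 :=
  RatDeriv.fn_div p q hq

theorem ratFunc_deriv_add (f g : RatFunc E) : (f + g)′ = f′ + g′ :=
  RatDeriv.fn_add f g

theorem ratFunc_deriv_zero : (0 : RatFunc E)′ = 0 := by
  have h := ratFunc_deriv_add (0 : RatFunc E) 0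
  rwa [add_zero, left_eq_add] at h

theorem not_dvd_derivative_of_irreducible [CharZero E] {p : E[X]} (hp : Irreducible p) :
    ¬p ∣ derivative p := fun h =>
  hp.not_isUnit (hp.separable.isUnit_of_dvd' dvd_rfl h)

theorem not_dvd_natCast_of_irreducible [CharZero E] {p : E[X]} (hp : Irreducible p) {n : ℕ}
    (hn : n ≠ 0) : ¬p ∣ (n : E[X]) := by
  intro h
  refine hp.not_isUnit (isUnit_of_dvd_unit h ?_)
  rw [← C_eq_natCast, isUnit_C]
  exact (Nat.cast_ne_zero.2 hn).isUnit

/-- The denominator `Q` of a solution `P / Q` of `g' + (k₁ / k₂) g = N / (b k₂)` is trivial if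
`b` is squarefree and coprime to `k₂`, and `k₁ / k₂` is differential-reduced. -/
theorem isUnit_of_mul_eq [CharZero E] {k₁ k₂ P Q b N : E[X]}
    (hred : ∀ i : ℤ, IsCoprime k₂ (k₁ - (i : E[X]) * derivative k₂)) (hb : Squarefree b)
    (hbk : IsCoprime b k₂) (hPQ : IsCoprime P Q) (hQ : Q ≠ 0)
    (h : b * (k₂ * (derivative P * Q - P * derivative Q) + k₁ * P * Q) = N * Q ^ 2) :
    IsUnit Q := by
  by_contra hu
  obtain ⟨p, hp, hpQ⟩ := WfDvdMonoid.exists_irreducible_factor hu hQ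
  have hpp := hp.prime
  have hpP : ¬p ∣ P := fun h => hp.not_isUnit (hPQ.isUnit_of_dvd' h hpQ)
  obtain ⟨m, Q₁, rfl, hQ₁⟩ : ∃ m Q₁, Q = p ^ m * Q₁ ∧ ¬p ∣ Q₁ := ⟨_,
    (FiniteMultiplicity.of_not_isUnit hp.not_isUnit hQ).exists_eq_pow_mul_and_not_dvd⟩
  obtain ⟨n, rfl⟩ : ∃ n, m = n + 1 := by
    refine Nat.exists_eq_succ_of_ne_zero ?_
    rintro rfl
    simp [hQ₁] at hpQ
  have h1 : b * (k₂ * (derivative P * p * Q₁ - P * (((n + 1 : ℕ) : E[X]) * derivative p * Q₁ +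
      p * derivative Q₁)) + k₁ * P * p * Q₁) = N * p ^ (n + 2) * Q₁ ^ 2 := by
    apply mul_left_cancel₀ (pow_ne_zero n hp.ne_zero)
    simp only [derivative_mul, derivative_pow_succ, map_add, map_one, map_natCast] at h
    push_cast
    linear_combination h
  -- At a factor of `k₂` the leading coefficient of the pole is governed by `k₁ - (n + 1) k₂'`
  -- modulo `p`, where `k₂' ≡ p' k₃` for `k₂ = p k₃`. Differential-reducedness makes it prime to
  -- `p`.
  by_cases hpk : p ∣ k₂
  · obtain ⟨k₃, rfl⟩ := hpk
    have hpb : ¬p ∣ b := fun h => hp.not_isUnit (hbk.isUnit_of_dvd' h (dvd_mul_right _ _))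
    have h2 : b * (k₃ * (derivative P * p * Q₁ - P * (((n + 1 : ℕ) : E[X]) * derivative p * Q₁ +
        p * derivative Q₁)) + k₁ * P * Q₁) = N * p ^ (n + 1) * Q₁ ^ 2 := by
      apply mul_left_cancel₀ hp.ne_zero
      linear_combination h1
    have h3 : p ∣ b * (P * (Q₁ * (k₁ - (((n + 1 : ℕ) : ℤ) : E[X]) * derivative (p * k₃)))) := by
      refine ⟨N * p ^ n * Q₁ ^ 2 - b * (k₃ * (derivative P * Q₁ - P * derivative Q₁)) -
        b * (P * (Q₁ * (((n + 1 : ℕ) : E[X]) * derivative k₃))), ?_⟩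
      simp only [derivative_mul, Int.cast_natCast]
      linear_combination h2
    rcases hpp.dvd_or_dvd h3 with h3 | h3
    · exact hpb h3
    rcases hpp.dvd_or_dvd h3 with h3 | h3
    · exact hpP h3
    rcases hpp.dvd_or_dvd h3 with h3 | h3
    · exact hQ₁ h3
    exact hp.not_isUnit ((hred (n + 1 : ℕ)).isUnit_of_dvd' (dvd_mul_right _ _) h3)
  -- Away from `k₂`, differentiation gives a pole of order `n + 2 ≥ 2`, whose leading coefficient is
  -- prime to `p` in characteristic zero. Applied twice, this forces `p * p ∣ b`.
  · have hT : ∀ c : E[X], p ∣ c * (k₂ * (P * (((n + 1 : ℕ) : E[X]) * (derivative p * Q₁)))) →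
        p ∣ c := by
      intro c hc
      rcases hpp.dvd_or_dvd hc with hc | hc
      · exact hc
      rcases hpp.dvd_or_dvd hc with hc | hc
      · exact absurd hc hpk
      rcases hpp.dvd_or_dvd hc with hc | hc
      · exact absurd hc hpP
      rcases hpp.dvd_or_dvd hc with hc | hc
      · exact absurd hc (not_dvd_natCast_of_irreducible hp n.succ_ne_zero)
      rcases hpp.dvd_or_dvd hc with hc | hc
      · exact absurd hc (not_dvd_derivative_of_irreducible hp)
      · exact absurd hc hQ₁
    obtain ⟨b₁, rfl⟩ := hT b ⟨b * (k₂ * (derivative P * Q₁ - P * derivative Q₁) + k₁ * P * Q₁) -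
      N * p ^ (n + 1) * Q₁ ^ 2, by linear_combination -h1⟩
    have h2 : b₁ * (k₂ * (derivative P * p * Q₁ - P * (((n + 1 : ℕ) : E[X]) * derivative p * Q₁ +
        p * derivative Q₁)) + k₁ * P * p * Q₁) = N * p ^ (n + 1) * Q₁ ^ 2 := by
      apply mul_left_cancel₀ hp.ne_zero
      linear_combination h1
    have h3 := hT b₁ ⟨b₁ * (k₂ * (derivative P * Q₁ - P * derivative Q₁) + k₁ * P * Q₁) -
      N * p ^ n * Q₁ ^ 2, by linear_combination -h2⟩
    exact hp.not_isUnit (hb p (mul_dvd_mul_left p h3))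

theorem coeff_eq_zero_of_mem_standardComplement {M : Submodule E E[X]} {v f : E[X]}
    (hv : v ∈ standardComplement M) (hf : f ∈ M) (hf0 : f ≠ 0) : v.coeff f.natDegree = 0 := by
  induction hv using Submodule.span_induction with
  | mem x hx =>
    obtain ⟨l, hl, rfl⟩ := hx
    rw [coeff_X_pow, if_neg (hl f hf hf0)]
  | zero => simp
  | add x y _ _ hx hy => rw [coeff_add, hx, hy, add_zero]
  | smul a x _ hx => rw [coeff_smul, hx, smul_zero]

/-- A nonzero common element would have a vanishing coefficient at its own degree. -/
theorem eq_zero_of_mem_standardComplement {M : Submodule E E[X]} {v : E[X]}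
    (hv : v ∈ standardComplement M) (hvM : v ∈ M) : v = 0 := by
  by_contra h
  exact h (leadingCoeff_eq_zero.1 (coeff_eq_zero_of_mem_standardComplement hv hvM h))

theorem mem_standardComplement_of_coeff {M : Submodule E E[X]} {v : E[X]}
    (h : ∀ f ∈ M, f ≠ 0 → v.coeff f.natDegree = 0) : v ∈ standardComplement M := by
  rw [v.as_sum_support_C_mul_X_pow]
  refine Submodule.sum_mem _ fun l hl => ?_
  rw [← smul_eq_C_mul]
  refine Submodule.smul_mem _ _ (Submodule.subset_span ⟨l, ?_, rfl⟩)
  rintro f hf hf0 rfl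
  exact mem_support_iff.1 hl (h f hf hf0)

theorem mem_reductionSubspace {K : RatFunc E} {f : E[X]} :
    f ∈ reductionSubspace K ↔ ∃ p, K.denom * derivative p + K.num * p = f := by
  simp [reductionSubspace, reductionMap, LinearMap.mem_range]

/-- The pole analysis of `isUnit_of_mul_eq` leaves only polynomial `g`. Clearing denominators then
gives `b ∣ q`, against the degrees unless `q = 0`, and `v` becomes the image of `g` under the
reduction map. -/
theorem IsResidualForm.eq_zero [CharZero E] {K r g : RatFunc E} (hK : IsDifferentialReduced K)
    (hr : IsResidualForm K r) (h : g′ + K * g = r) : r = 0 := by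
  obtain ⟨q, b, v, hb, hbk, hq, hv, rfl⟩ := hr
  have hb0 : b ≠ 0 := hb.ne_zero
  have hk0 := K.denom_ne_zero
  have hg0 := g.denom_ne_zero
  have cb0 := RatFunc.algebraMap_ne_zero (K := E) hb0
  have ck0 := RatFunc.algebraMap_ne_zero (K := E) hk0
  have cg0 := RatFunc.algebraMap_ne_zero (K := E) hg0
  have key : ∀ P Q : E[X], Q ≠ 0 →
      g = algebraMap E[X] (RatFunc E) P / algebraMap E[X] (RatFunc E) Q →
      b * (K.denom * (derivative P * Q - P * derivative Q) + K.num * P * Q) =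
        (q * K.denom + v * b) * Q ^ 2 := by
    intro P Q hQ hg
    have cQ0 := RatFunc.algebraMap_ne_zero (K := E) hQ
    apply RatFunc.algebraMap_injective E
    have hK' := K.num_div_denom
    generalize K.num = k₁ at *
    generalize K.denom = k₂ at *
    rw [hg, ratFunc_deriv_div P hQ, ← hK'] at h
    field_simp at h
    simp only [map_mul, map_add, map_sub, map_pow]
    linear_combination h
  have hu := isUnit_of_mul_eq hK hb hbk g.isCoprime_num_denom hg0
    (key _ _ hg0 g.num_div_denom.symm)
  obtain ⟨P, rfl⟩ : ∃ P, g = algebraMap E[X] (RatFunc E) P := by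
    obtain ⟨c, hc, hc'⟩ := isUnit_iff.1 hu
    refine ⟨C c⁻¹ * g.num, ?_⟩
    conv_lhs => rw [← g.num_div_denom]
    rw [div_eq_iff cg0, ← map_mul, ← hc']
    congr 1
    have : C c⁻¹ * C c = (1 : E[X]) := by rw [← C_mul, inv_mul_cancel₀ hc.ne_zero, C_1]
    linear_combination (-g.num) * this
  have h1 := key P 1 one_ne_zero (by simp)
  simp only [mul_one, derivative_one, mul_zero, sub_zero, one_pow] at h1
  have hbq : b ∣ q := hbk.dvd_of_dvd_mul_right
    ⟨K.denom * derivative P + K.num * P - v, by linear_combination -h1⟩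
  have hq0 : q = 0 := eq_zero_of_dvd_of_degree_lt hbq hq
  subst hq0
  have hv0 : v = 0 := eq_zero_of_mem_standardComplement hv (mem_reductionSubspace.2 ⟨P, by
    apply mul_left_cancel₀ hb0
    linear_combination h1⟩)
  simp [hv0]

theorem IsResidualForm.sub {K r s : RatFunc E} (hr : IsResidualForm K r)
    (hs : IsResidualForm K s) : IsResidualForm K (r - s) := by
  obtain ⟨q₁, b₁, v₁, hb₁, hbk₁, hq₁, hv₁, rfl⟩ := hr
  obtain ⟨q₂, b₂, v₂, hb₂, hbk₂, hq₂, hv₂, rfl⟩ := hs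
  have h0 : b₁ * b₂ ≠ 0 := mul_ne_zero hb₁.ne_zero hb₂.ne_zero
  -- The radical of the product is a squarefree common denominator, and as a divisor of `b₁ * b₂` it
  -- stays coprime to the denominator of the kernel.
  obtain ⟨b, hb, hbd, hd₁, hd₂⟩ : ∃ b : E[X], Squarefree b ∧ b ∣ b₁ * b₂ ∧ b₁ ∣ b ∧ b₂ ∣ b := by
    classical
    refine ⟨UniqueFactorizationMonoid.radical (b₁ * b₂),
      UniqueFactorizationMonoid.squarefree_radical, UniqueFactorizationMonoid.radical_dvd_self,
      ?_, ?_⟩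
    · exact (UniqueFactorizationMonoid.dvd_radical_iff hb₁.isRadical h0).2 (dvd_mul_right _ _)
    · exact (UniqueFactorizationMonoid.dvd_radical_iff hb₂.isRadical h0).2 (dvd_mul_left _ _)
  obtain ⟨c₁, rfl⟩ := hd₁
  obtain ⟨c₂, hc₂⟩ := hd₂
  have hb0 := hb.ne_zero
  have hc₁0 : c₁ ≠ 0 := right_ne_zero_of_mul hb0
  have hc₂0 : c₂ ≠ 0 := by
    rintro rfl
    exact hb0 (by rw [hc₂, mul_zero])
  refine ⟨q₁ * c₁ - q₂ * c₂, b₁ * c₁, v₁ - v₂, hb,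
    (hbk₁.mul_left hbk₂).of_isCoprime_of_dvd_left hbd, ?_, Submodule.sub_mem _ hv₁ hv₂, ?_⟩
  · refine (degree_sub_le _ _).trans_lt (max_lt ?_ ?_)
    · rw [degree_mul, degree_mul]
      exact WithBot.add_lt_add_right (by simpa using hc₁0) hq₁
    · rw [hc₂, degree_mul, degree_mul]
      exact WithBot.add_lt_add_right (by simpa using hc₂0) hq₂
  · have e₁ := RatFunc.algebraMap_ne_zero (K := E) hb₁.ne_zero
    have e₂ := RatFunc.algebraMap_ne_zero (K := E) hb₂.ne_zero
    have e₃ := RatFunc.algebraMap_ne_zero (K := E) hc₁0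
    have e₄ := RatFunc.algebraMap_ne_zero (K := E) hc₂0
    have e₅ := congrArg (algebraMap E[X] (RatFunc E)) hc₂
    simp only [map_mul, map_sub] at e₅ ⊢
    have e₆ : algebraMap E[X] (RatFunc E) q₁ / algebraMap E[X] (RatFunc E) b₁ =
      algebraMap E[X] (RatFunc E) q₁ * algebraMap E[X] (RatFunc E) c₁ /
        (algebraMap E[X] (RatFunc E) b₁ * algebraMap E[X] (RatFunc E) c₁) := by
      field_simp
    have e₇ : algebraMap E[X] (RatFunc E) q₂ / algebraMap E[X] (RatFunc E) b₂ =
      algebraMap E[X] (RatFunc E) q₂ * algebraMap E[X] (RatFunc E) c₂ /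
        (algebraMap E[X] (RatFunc E) b₁ * algebraMap E[X] (RatFunc E) c₁) := by
      rw [e₅]
      field_simp
    rw [e₆, e₇]
    ring

theorem IsResidualForm.unique [CharZero E] {K r s g : RatFunc E} (hK : IsDifferentialReduced K)
    (hr : IsResidualForm K r) (hs : IsResidualForm K s) (h : g′ + K * g = r - s) : r = s :=
  sub_eq_zero.1 ((hr.sub hs).eq_zero hK h)

end Uniqueness

/-! ### Hermite reduction of the shell -/

section Reduction

variable {E : Type u} [Field E]

/-- Hermite reduction of the poles of `s₁ / s₂` away from those of the kernel `k₁ / k₂`. -/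
theorem exists_hermite_reduction [CharZero E] {k₁ k₂ : E[X]} (hk₂ : k₂ ≠ 0) (n : ℕ) :
    ∀ s₁ s₂ : E[X], s₂.natDegree = n → s₂ ≠ 0 → IsCoprime s₂ k₂ →
      ∃ (g : RatFunc E) (q b w : E[X]), b.Monic ∧ b.Separable ∧ IsCoprime b k₂ ∧
        q.degree < b.degree ∧
        algebraMap E[X] (RatFunc E) s₁ / algebraMap E[X] (RatFunc E) s₂ =
          g′ + algebraMap E[X] (RatFunc E) k₁ / algebraMap E[X] (RatFunc E) k₂ * g +
            algebraMap E[X] (RatFunc E) q / algebraMap E[X] (RatFunc E) b +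
            algebraMap E[X] (RatFunc E) w / algebraMap E[X] (RatFunc E) k₂ := by
  induction n using Nat.strong_induction_on with
  | _ n ih =>
  intro s₁ s₂ hn hs hsk
  have ck := RatFunc.algebraMap_ne_zero (K := E) hk₂
  have cs := RatFunc.algebraMap_ne_zero (K := E) hs
  by_cases hsep : s₂.Separable
  · have hl : s₂.leadingCoeff⁻¹ ≠ 0 := inv_ne_zero (leadingCoeff_ne_zero.2 hs)
    have hu : IsUnit (C s₂.leadingCoeff⁻¹) := isUnit_C.2 hl.isUnit
    have hdeg : (C s₂.leadingCoeff⁻¹ * s₂).degree = s₂.degree := degree_C_mul hl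
    -- The polynomial part of the fraction is moved over `k₂`; the scalar makes the denominator
    -- monic.
    refine ⟨0, C s₂.leadingCoeff⁻¹ * (s₁ % s₂), C s₂.leadingCoeff⁻¹ * s₂, s₁ / s₂ * k₂, ?_, ?_, ?_,
      ?_, ?_⟩
    · rw [mul_comm]
      exact monic_mul_leadingCoeff_inv hs
    · exact hsep.unit_mul hu
    · exact (isCoprime_mul_unit_left_left hu _ _).2 hsk
    · rw [hdeg, degree_C_mul hl]
      exact EuclideanDomain.mod_lt s₁ hs
    · have cu := RatFunc.algebraMap_ne_zero (K := E) hu.ne_zero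
      have e := congrArg (algebraMap E[X] (RatFunc E)) (EuclideanDomain.div_add_mod s₁ s₂)
      generalize C s₂.leadingCoeff⁻¹ = u at cu
      rw [ratFunc_deriv_zero]
      simp only [map_mul, map_add] at e ⊢
      field_simp
      linear_combination -algebraMap E[X] (RatFunc E) k₂ * e
  · obtain ⟨p, hp, hps, hps'⟩ : ∃ p, Irreducible p ∧ p ∣ s₂ ∧ p ∣ derivative s₂ := by
      by_contra! h
      exact hsep (isCoprime_of_irreducible_dvd (fun h => hs h.1) h)
    obtain ⟨m, t, rfl, ht⟩ : ∃ m t, s₂ = p ^ m * t ∧ ¬p ∣ t := ⟨_,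
      (FiniteMultiplicity.of_not_isUnit hp.not_isUnit hs).exists_eq_pow_mul_and_not_dvd⟩
    have hp' := not_dvd_derivative_of_irreducible hp
    have hp't : ¬p ∣ derivative p * t := fun h => (hp.prime.dvd_or_dvd h).elim hp' ht
    obtain ⟨j, rfl⟩ : ∃ j, m = j + 2 := by
      rcases m with _ | _ | j
      · simp [ht] at hps
      · refine absurd ?_ hp't
        rw [zero_add, pow_one, derivative_mul] at hps'
        exact (dvd_add_left (dvd_mul_right p _)).1 hps'
      · exact ⟨j, rfl⟩
    have ht0 : t ≠ 0 := right_ne_zero_of_mul hs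
    obtain ⟨x, y, hxy⟩ := (hp.coprime_iff_not_dvd).2 hp't
    have hj : ((j + 1 : ℕ) : E) ≠ 0 := Nat.cast_ne_zero.2 j.succ_ne_zero
    -- The derivative of `A / p ^ (j + 1)` has leading term `-(j + 1) A p' / p ^ (j + 2)`. So `A` is
    -- chosen to cancel `s₁ / t` modulo `p`, which is possible because `(j + 1) p' t` is invertible
    -- there.
    obtain ⟨A, z, hz⟩ : ∃ A z, s₁ + ((j + 1 : ℕ) : E[X]) * A * derivative p * t = p * z := by
      refine ⟨-C ((j + 1 : ℕ) : E)⁻¹ * s₁ * y, x * s₁, ?_⟩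
      have : C ((j + 1 : ℕ) : E)⁻¹ * ((j + 1 : ℕ) : E[X]) = 1 := by
        rw [← C_eq_natCast, ← C_mul, inv_mul_cancel₀ hj, C_1]
      linear_combination (-s₁ * y * derivative p * t) * this - s₁ * hxy
    have hu0 : p ^ (j + 1) * t ≠ 0 := mul_ne_zero (pow_ne_zero _ hp.ne_zero) ht0
    have huk : IsCoprime (p ^ (j + 1) * t) k₂ :=
      hsk.of_isCoprime_of_dvd_left ⟨p, by ring⟩
    obtain ⟨a, b', hab⟩ := id huk
    have hlt : (p ^ (j + 1) * t).natDegree < n := by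
      have : p ^ (j + 2) * t = p * (p ^ (j + 1) * t) := by ring
      rw [← hn, this, natDegree_mul hp.ne_zero hu0]
      have := hp.natDegree_pos
      omega
    set N := z * k₂ - derivative A * t * k₂ - k₁ * A * t with hN
    obtain ⟨g, q, b, w, hb, hbs, hbk, hq, h⟩ := ih _ hlt (N * b') (p ^ (j + 1) * t) rfl hu0 huk
    refine ⟨algebraMap E[X] (RatFunc E) A / algebraMap E[X] (RatFunc E) (p ^ (j + 1)) + g, q, b,
      w + N * a, hb, hbs, hbk, hq, ?_⟩
    have cp := RatFunc.algebraMap_ne_zero (K := E) hp.ne_zero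
    have ct := RatFunc.algebraMap_ne_zero (K := E) ht0
    rw [ratFunc_deriv_add, ratFunc_deriv_div A (pow_ne_zero _ hp.ne_zero)]
    have e1 := congrArg (algebraMap E[X] (RatFunc E)) hz
    have e2 := congrArg (algebraMap E[X] (RatFunc E)) hab
    have e3 := congrArg (algebraMap E[X] (RatFunc E)) hN
    have e4 : derivative (p ^ (j + 1)) = ((j + 1 : ℕ) : E[X]) * p ^ j * derivative p := by
      rw [derivative_pow_succ]
      simp
    rw [e4]
    simp only [map_mul, map_add, map_sub, map_pow, map_one, map_natCast] at e1 e2 e3 h ⊢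
    generalize algebraMap E[X] (RatFunc E) N = cN at *
    have key1 : algebraMap E[X] (RatFunc E) s₁ / (algebraMap E[X] (RatFunc E) p ^ (j + 2) *
        algebraMap E[X] (RatFunc E) t) =
        (algebraMap E[X] (RatFunc E) (derivative A) * algebraMap E[X] (RatFunc E) p ^ (j + 1) -
          algebraMap E[X] (RatFunc E) A * (((j + 1 : ℕ) : RatFunc E) *
            algebraMap E[X] (RatFunc E) p ^ j * algebraMap E[X] (RatFunc E) (derivative p))) /
          (algebraMap E[X] (RatFunc E) p ^ (j + 1)) ^ 2 +
        algebraMap E[X] (RatFunc E) k₁ / algebraMap E[X] (RatFunc E) k₂ *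
          (algebraMap E[X] (RatFunc E) A / algebraMap E[X] (RatFunc E) p ^ (j + 1)) +
        cN / (algebraMap E[X] (RatFunc E) p ^ (j + 1) * algebraMap E[X] (RatFunc E) t *
          algebraMap E[X] (RatFunc E) k₂) := by
      rw [e3, eq_sub_of_add_eq e1]
      field_simp
      ring
    -- Partial fractions separate the remaining poles from those of the kernel; only the first
    -- summand is passed to the induction.
    have key2 : cN / (algebraMap E[X] (RatFunc E) p ^ (j + 1) * algebraMap E[X] (RatFunc E) t *
          algebraMap E[X] (RatFunc E) k₂) =
        cN * algebraMap E[X] (RatFunc E) b' / (algebraMap E[X] (RatFunc E) p ^ (j + 1) *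
          algebraMap E[X] (RatFunc E) t) +
        cN * algebraMap E[X] (RatFunc E) a / algebraMap E[X] (RatFunc E) k₂ := by
      field_simp
      linear_combination -cN * e2
    rw [key1, key2, h]
    ring

end Reduction

/-! ### Polynomial reduction -/

section PolynomialReduction

variable {E : Type u} [Field E]

/-- The image of `p` under polynomial reduction with respect to the fraction `k₁ / k₂`. -/
noncomputable def reduct (k₁ k₂ p : E[X]) : E[X] :=
  k₂ * derivative p + k₁ * p

theorem reduct_add (k₁ k₂ p q : E[X]) :
    reduct k₁ k₂ (p + q) = reduct k₁ k₂ p + reduct k₁ k₂ q := by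
  simp only [reduct, derivative_add]
  ring

theorem reduct_C_mul (k₁ k₂ p : E[X]) (a : E) :
    reduct k₁ k₂ (C a * p) = C a * reduct k₁ k₂ p := by
  simp only [reduct, derivative_C_mul]
  ring

theorem degree_lt_of_natDegree_le_of_coeff {p : E[X]} {n : ℕ} (h : p.natDegree ≤ n)
    (h0 : p.coeff n = 0) : p.degree < n := by
  rw [degree_lt_iff_coeff_zero]
  intro m hm
  rcases hm.eq_or_lt with rfl | hm
  · exact h0
  · exact coeff_eq_zero_of_natDegree_lt (h.trans_lt hm)

theorem natDegree_le_of_degree_lt_succ {p : E[X]} {n : ℕ} (h : p.degree < (n + 1 : ℕ)) :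
    p.natDegree ≤ n := by
  rw [natDegree_le_iff_coeff_eq_zero]
  exact fun m hm => (degree_lt_iff_coeff_zero _ _).1 h m hm

theorem degree_lt_succ_of_natDegree_le {p : E[X]} {n : ℕ} (h : p.natDegree ≤ n) :
    p.degree < (n + 1 : ℕ) :=
  degree_lt_of_natDegree_le_of_coeff (h.trans n.le_succ)
    (coeff_eq_zero_of_natDegree_lt (Nat.lt_succ_of_le h))

/-- The factor by which the reduction map multiplies the coefficient of degree `n`. -/
def reductCoeff (k₁ k₂ : E[X]) (D n : ℕ) : E :=
  k₁.coeff D + n * k₂.coeff (D + 1)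

section

variable {k₁ k₂ : E[X]} {D : ℕ}

theorem natDegree_reduct_le (h₁ : k₁.natDegree ≤ D) (h₂ : k₂.natDegree ≤ D + 1) {p : E[X]} {n : ℕ}
    (hp : p.natDegree ≤ n) : (reduct k₁ k₂ p).natDegree ≤ n + D := by
  refine natDegree_add_le_of_degree_le ?_ ?_
  · rcases n with _ | n
    · rw [eq_C_of_natDegree_le_zero hp]
      simp
    · refine natDegree_mul_le.trans ?_
      have := natDegree_derivative_le p
      omega
  · refine natDegree_mul_le.trans ?_
    omega

theorem coeff_reduct (h₁ : k₁.natDegree ≤ D) (h₂ : k₂.natDegree ≤ D + 1) {p : E[X]} {n : ℕ}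
    (hp : p.natDegree ≤ n) :
    (reduct k₁ k₂ p).coeff (n + D) = reductCoeff k₁ k₂ D n * p.coeff n := by
  rw [reduct, coeff_add, add_comm n D, coeff_mul_add_eq_of_natDegree_le h₁ hp, reductCoeff]
  rcases n with _ | n
  · rw [eq_C_of_natDegree_le_zero hp]
    simp
  · have hd : (derivative p).natDegree ≤ n := (natDegree_derivative_le p).trans (by omega)
    rw [show D + (n + 1) = (D + 1) + n by ring, coeff_mul_add_eq_of_natDegree_le h₂ hd,
      coeff_derivative]
    push_cast
    ring

/-- The coefficients of degree `N - 1 + D` down to `a + D` are eliminated in turn by images of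
monomials `C t * X ^ n`. Only the factors with `a ≤ n < N` must be nonzero, so the exceptional index
can be left out. -/
theorem exists_degree_sub_reduct_lt (h₁ : k₁.natDegree ≤ D) (h₂ : k₂.natDegree ≤ D + 1)
    {a N : ℕ} (haN : a ≤ N) : ∀ w : E[X], w.degree < (N + D : ℕ) →
      (∀ n, a ≤ n → n < N → reductCoeff k₁ k₂ D n ≠ 0) →
      ∃ p : E[X], p.degree < N ∧ (w - reduct k₁ k₂ p).degree < (a + D : ℕ) := by
  induction N, haN using Nat.le_induction with
  | base =>
    intro w hw _
    exact ⟨0, by simp, by simpa [reduct] using hw⟩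
  | succ N haN ih =>
    intro w hw hc
    have hN := hc N haN N.lt_succ_self
    set t := w.coeff (N + D) / reductCoeff k₁ k₂ D N with ht
    have hX : (C t * X ^ N).natDegree ≤ N := natDegree_C_mul_X_pow_le t N
    have hw' : (w - reduct k₁ k₂ (C t * X ^ N)).degree < (N + D : ℕ) := by
      apply degree_lt_of_natDegree_le_of_coeff
      · refine (natDegree_sub_le _ _).trans (max_le ?_ (natDegree_reduct_le h₁ h₂ hX))
        apply natDegree_le_of_degree_lt_succ
        rwa [show N + D + 1 = N + 1 + D by ring]
      · rw [coeff_sub, coeff_reduct h₁ h₂ hX, coeff_C_mul_X_pow, if_pos rfl, ht]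
        field_simp
        ring
    obtain ⟨p, hp, h⟩ := ih _ hw' fun n hn hn' => hc n hn (hn'.trans N.lt_succ_self)
    refine ⟨C t * X ^ N + p, ?_, ?_⟩
    · refine (degree_add_le _ _).trans_lt (max_lt (degree_lt_succ_of_natDegree_le hX) ?_)
      exact hp.trans (by exact_mod_cast N.lt_succ_self)
    · rwa [reduct_add, ← sub_sub]

/-- A criterion, in terms of degrees, for `v` to lie in the standard complement of the subspace
for polynomial reduction with respect to the fraction `k₁ / k₂`. -/
def IsReduced (k₁ k₂ v : E[X]) : Prop :=
  ∃ D : ℕ, k₁.natDegree ≤ D ∧ k₂.natDegree ≤ D + 1 ∧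
    (v = 0 ∨ (v.degree < D ∧ ∀ n, reductCoeff k₁ k₂ D n ≠ 0) ∨
      (k₁.coeff D ≠ 0 ∨ k₂.coeff (D + 1) ≠ 0) ∧
      ∃ (m e : ℕ) (p u z w : E[X]) (ε γ : E), p.degree < m ∧
        (reduct k₁ k₂ (p + X ^ m)).degree < D ∧
        reduct k₁ k₂ (p + X ^ m) = u + C ε * X ^ e ∧ u.degree < e ∧
        (ε ≠ 0 ∨ reduct k₁ k₂ (p + X ^ m) = 0) ∧ z.degree < e ∧
        (z + X ^ (e + 1) * w).degree < (D : WithBot ℕ) ∧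
        v = z + X ^ (e + 1) * w + C γ * X ^ (m + D))

/-- The factor is affine in `n` and not identically zero, so in characteristic zero it has at most
one natural root. -/
theorem reductCoeff_ne_zero [CharZero E] (h : k₁.coeff D ≠ 0 ∨ k₂.coeff (D + 1) ≠ 0) {m n : ℕ}
    (hm : reductCoeff k₁ k₂ D m = 0) (hn : n ≠ m) : reductCoeff k₁ k₂ D n ≠ 0 := by
  intro hn0
  rw [reductCoeff] at hm hn0
  have h2 : k₂.coeff (D + 1) = 0 := by
    have : ((n : E) - m) * k₂.coeff (D + 1) = 0 := by linear_combination hn0 - hm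
    exact (mul_eq_zero.1 this).resolve_left (sub_ne_zero.2 (Nat.cast_injective.ne hn))
  rw [h2, mul_zero, add_zero] at hm
  exact h.elim (fun h => h hm) (fun h => h h2)

theorem natDegree_reduct (h₁ : k₁.natDegree ≤ D) (h₂ : k₂.natDegree ≤ D + 1) {p u : E[X]}
    (hp : p ≠ 0) (hc : reductCoeff k₁ k₂ D p.natDegree ≠ 0) (hu : u.degree < D) :
    (reduct k₁ k₂ p + u).natDegree = p.natDegree + D := by
  apply natDegree_eq_of_le_of_coeff_ne_zero
  · refine natDegree_add_le_of_degree_le (natDegree_reduct_le h₁ h₂ le_rfl) ?_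
    exact natDegree_le_of_degree_le (hu.le.trans (by exact_mod_cast Nat.le_add_left _ _))
  · rw [coeff_add, coeff_reduct h₁ h₂ le_rfl,
      (degree_lt_iff_coeff_zero _ _).1 hu _ (Nat.le_add_left _ _), add_zero]
    exact mul_ne_zero hc (leadingCoeff_ne_zero.2 hp)

/-- In the exceptional case the degrees in the image are `n + D` for `n ≠ m`, and `e` if the image
of `p + X ^ m` is nonzero. The shape of `v` avoids them all: `X ^ (m + D)` may occur, and below
degree `D` only the power `X ^ e` is skipped. -/
theorem IsReduced.coeff_eq_zero [CharZero E] {v p : E[X]} (hv : IsReduced k₁ k₂ v)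
    (hp : reduct k₁ k₂ p ≠ 0) : v.coeff (reduct k₁ k₂ p).natDegree = 0 := by
  obtain ⟨D, h₁, h₂, rfl | ⟨hv, hc⟩ | ⟨h0, m, e, P, u, z, w, ε, γ, hP, hr, hu, hue, hε, hz, hzw,
    rfl⟩⟩ := hv
  · simp
  · have hp0 : p ≠ 0 := by
      rintro rfl
      simp [reduct] at hp
    have := natDegree_reduct h₁ h₂ (u := 0) hp0 (hc _) (by simp)
    rw [add_zero] at this
    rw [this]
    exact (degree_lt_iff_coeff_zero _ _).1 hv _ (Nat.le_add_left _ _)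
  · have hPm : (P + X ^ m).coeff m = 1 := by
      rw [coeff_add, (degree_lt_iff_coeff_zero _ _).1 hP _ le_rfl, coeff_X_pow, if_pos rfl,
        zero_add]
    have hPd : (P + X ^ m).natDegree ≤ m :=
      natDegree_add_le_of_degree_le (natDegree_le_of_degree_le hP.le) (natDegree_X_pow_le m)
    have hm : reductCoeff k₁ k₂ D m = 0 := by
      have := coeff_reduct h₁ h₂ hPd
      rwa [hPm, mul_one, (degree_lt_iff_coeff_zero _ _).1 hr _ (Nat.le_add_left _ _), eq_comm]
        at this
    set a := p.coeff m
    -- The remainder has no term of degree `m`. If it is nonzero, it alone determines the degree of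
    -- the image, since the exceptional part has image of degree below `D`.
    have hpa : p = (p - C a * (P + X ^ m)) + C a * (P + X ^ m) := by ring
    set p' := p - C a * (P + X ^ m) with hp'
    have hp'm : p'.coeff m = 0 := by
      rw [hp', coeff_sub, coeff_C_mul, hPm, mul_one, sub_self]
    have hred : reduct k₁ k₂ p = reduct k₁ k₂ p' + C a * reduct k₁ k₂ (P + X ^ m) := by
      conv_lhs => rw [hpa, reduct_add, reduct_C_mul]
    by_cases hp'0 : p' = 0
    · have hred' : reduct k₁ k₂ p = C a * reduct k₁ k₂ (P + X ^ m) := by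
        rw [hred, hp'0]
        simp [reduct]
      rw [hred'] at hp ⊢
      have ha : a ≠ 0 := by
        intro ha
        simp [ha] at hp
      rw [natDegree_C_mul ha]
      have hε' := hε.resolve_right (right_ne_zero_of_mul hp)
      have hdeg : (reduct k₁ k₂ (P + X ^ m)).natDegree = e := by
        rw [hu]
        apply natDegree_eq_of_le_of_coeff_ne_zero
        · exact natDegree_add_le_of_degree_le (natDegree_le_of_degree_le hue.le)
            (natDegree_C_mul_X_pow_le ε e)
        · rwa [coeff_add, (degree_lt_iff_coeff_zero _ _).1 hue _ le_rfl, coeff_C_mul_X_pow,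
            if_pos rfl, zero_add]
      have heD : e < D := by
        rw [← hdeg]
        exact (natDegree_lt_iff_degree_lt (right_ne_zero_of_mul hp)).2 hr
      rw [hdeg, coeff_add, coeff_add, (degree_lt_iff_coeff_zero _ _).1 hz _ le_rfl,
        coeff_X_pow_mul', if_neg (by omega), coeff_C_mul_X_pow, if_neg (by omega)]
      simp
    · have hne : p'.natDegree ≠ m := by
        intro h
        rw [← h] at hp'm
        exact hp'0 (leadingCoeff_eq_zero.1 hp'm)
      have hr' : (C a * reduct k₁ k₂ (P + X ^ m)).degree < D := by
        rw [← smul_eq_C_mul]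
        exact (degree_smul_le _ _).trans_lt hr
      rw [hred, natDegree_reduct h₁ h₂ hp'0 (reductCoeff_ne_zero h0 hm hne) hr', coeff_add,
        (degree_lt_iff_coeff_zero _ _).1 hzw _ (Nat.le_add_left _ _), coeff_C_mul_X_pow,
        if_neg (by omega), add_zero]

end

theorem exists_derivative_eq [CharZero E] (w : E[X]) : ∃ p, derivative p = w := by
  induction w using Polynomial.induction_on' with
  | add p q hp hq =>
    obtain ⟨p', rfl⟩ := hp
    obtain ⟨q', rfl⟩ := hq
    exact ⟨p' + q', derivative_add⟩
  | monomial n a =>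
    refine ⟨Polynomial.monomial (n + 1) (a / ((n + 1 : ℕ) : E)), ?_⟩
    have : ((n + 1 : ℕ) : E) ≠ 0 := Nat.cast_ne_zero.2 n.succ_ne_zero
    rw [derivative_monomial, div_mul_cancel₀ _ this, Nat.add_sub_cancel]

theorem exists_eq_add_X_pow_mul {w : E[X]} {e : ℕ} (h : w.coeff e = 0) :
    ∃ z y : E[X], z.degree < e ∧ w = z + X ^ (e + 1) * y := by
  have hm : (X ^ (e + 1) : E[X]).Monic := monic_X_pow _
  refine ⟨w %ₘ X ^ (e + 1), w /ₘ X ^ (e + 1), ?_, (modByMonic_add_div w (X ^ (e + 1))).symm⟩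
  apply degree_lt_of_natDegree_le_of_coeff
  · apply natDegree_le_of_degree_lt_succ
    simpa using degree_modByMonic_lt w hm
  · have := congrArg (Polynomial.coeff · e) (modByMonic_add_div w (X ^ (e + 1) : E[X]))
    simpa [coeff_X_pow_mul', h] using this

/-- With `D` as small as possible, both top coefficients vanish only if `k₁ = 0` and `k₂` is
constant; then antiderivatives show that every polynomial is an image. Otherwise degrees are
eliminated from above, with special care at the one possible root `m` of the factor. -/
theorem exists_isReduced [CharZero E] {k₁ k₂ : E[X]} (hk : IsCoprime k₁ k₂)
    (w : E[X]) : ∃ p v, w = reduct k₁ k₂ p + v ∧ IsReduced k₁ k₂ v := by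
  set D := max k₁.natDegree (k₂.natDegree - 1) with hD
  have h₁ : k₁.natDegree ≤ D := le_max_left _ _
  have h₂ : k₂.natDegree ≤ D + 1 := by omega
  by_cases h0 : k₁.coeff D ≠ 0 ∨ k₂.coeff (D + 1) ≠ 0
  swap
  · push Not at h0
    have hk₁ : k₁ = 0 := by
      by_contra hk₁
      have hlt : k₁.natDegree ≠ D := by
        intro h
        rw [← h] at h0
        exact hk₁ (leadingCoeff_eq_zero.1 h0.1)
      have hk₂ : k₂.natDegree = D + 1 := by omega
      rw [← hk₂] at h0
      have := leadingCoeff_eq_zero.1 h0.2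
      simp [this] at hk₂
    subst hk₁
    obtain ⟨c, hc, rfl⟩ := isUnit_iff.1 (isCoprime_zero_left.1 hk)
    obtain ⟨p, hp⟩ := exists_derivative_eq (C c⁻¹ * w)
    refine ⟨p, 0, ?_, D, h₁, h₂, Or.inl rfl⟩
    rw [reduct, hp, ← mul_assoc, ← C_mul, mul_inv_cancel₀ hc.ne_zero]
    simp
  have hwlt : ∀ N, w.natDegree < N → w.degree < (N + D : ℕ) := fun N hN =>
    (degree_le_natDegree).trans_lt (by exact_mod_cast hN.trans_le (Nat.le_add_right _ _))
  by_cases hc : ∀ n, reductCoeff k₁ k₂ D n ≠ 0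
  · obtain ⟨p, -, hp⟩ := exists_degree_sub_reduct_lt h₁ h₂ (Nat.zero_le (w.natDegree + 1)) w
      (hwlt _ (Nat.lt_succ_self _)) fun n _ _ => hc n
    rw [zero_add] at hp
    exact ⟨p, w - reduct k₁ k₂ p, by ring, D, h₁, h₂, Or.inr (Or.inl ⟨hp, hc⟩)⟩
  push Not at hc
  obtain ⟨m, hm⟩ := hc
  have hcn : ∀ n, n ≠ m → reductCoeff k₁ k₂ D n ≠ 0 := fun n hn => reductCoeff_ne_zero h0 hm hn
  obtain ⟨P, hP, hr⟩ : ∃ P : E[X], P.degree < m ∧ (reduct k₁ k₂ (P + X ^ m)).degree < D := by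
    obtain ⟨P, hP, h⟩ := exists_degree_sub_reduct_lt h₁ h₂ (Nat.zero_le m)
      (reduct k₁ k₂ (X ^ m)) (degree_lt_of_natDegree_le_of_coeff
        (natDegree_reduct_le h₁ h₂ (natDegree_X_pow_le m)) (by
          rw [coeff_reduct h₁ h₂ (natDegree_X_pow_le m), hm, zero_mul]))
      fun n _ hn => hcn n hn.ne
    refine ⟨C (-1) * P, by rwa [degree_C_mul (by simp)], ?_⟩
    rw [reduct_add, reduct_C_mul]
    simpa [sub_eq_neg_add] using h
  -- Degrees above `m + D` are eliminated here. The term of degree `m + D` cannot be removed and is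
  -- set aside as `C γ * X ^ (m + D)`; afterwards the elimination resumes below `m`.
  obtain ⟨p₁, -, hp₁⟩ := exists_degree_sub_reduct_lt h₁ h₂ (a := m + 1)
    (N := max (m + 1) (w.natDegree + 1)) (le_max_left _ _) w (hwlt _ (by omega))
    fun n hn _ => hcn n (by omega)
  set w₁ := w - reduct k₁ k₂ p₁ with hw₁
  set γ := w₁.coeff (m + D) with hγ
  have hw₂ : (w₁ - C γ * X ^ (m + D)).degree < ((m + D : ℕ) : WithBot ℕ) := by
    apply degree_lt_of_natDegree_le_of_coeff
    · refine (natDegree_sub_le _ _).trans (max_le ?_ (natDegree_C_mul_X_pow_le _ _))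
      apply natDegree_le_of_degree_lt_succ
      rwa [show m + D + 1 = m + 1 + D by ring]
    · rw [coeff_sub, coeff_C_mul_X_pow, if_pos rfl, hγ, sub_self]
  obtain ⟨p₂, -, hp₂⟩ := exists_degree_sub_reduct_lt h₁ h₂ (Nat.zero_le m) _ hw₂
    fun n _ hn => hcn n hn.ne
  rw [zero_add] at hp₂
  set w₃ := w₁ - C γ * X ^ (m + D) - reduct k₁ k₂ p₂ with hw₃
  by_cases hu : reduct k₁ k₂ (P + X ^ m) = 0
  -- A zero exceptional image imposes no condition below `D`; the choice `e = D` makes the condition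
  -- on `z` the bound already known.
  · refine ⟨p₁ + p₂, w₃ + C γ * X ^ (m + D), ?_, D, h₁, h₂, Or.inr (Or.inr ⟨h0, m, D, P, 0, w₃, 0,
      0, γ, hP, hr, ?_, ?_, Or.inr hu, hp₂, ?_, ?_⟩)⟩
    · rw [reduct_add, hw₃, hw₁]
      ring
    · simp [hu]
    · simp
    · simpa using hp₂
    · ring
  · set u := reduct k₁ k₂ (P + X ^ m) with hu'
    have hlc : u.leadingCoeff ≠ 0 := leadingCoeff_ne_zero.2 hu
    -- The multiple of the exceptional image that clears the coefficient at its degree.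
    set b := w₃.coeff u.natDegree / u.leadingCoeff with hb
    have hw₄ : (w₃ - C b * u).coeff u.natDegree = 0 := by
      rw [coeff_sub, coeff_C_mul, coeff_natDegree, hb, div_mul_cancel₀ _ hlc, sub_self]
    obtain ⟨z, y, hz, hzy⟩ := exists_eq_add_X_pow_mul hw₄
    refine ⟨p₁ + p₂ + C b * (P + X ^ m), z + X ^ (u.natDegree + 1) * y + C γ * X ^ (m + D), ?_, D,
      h₁, h₂, Or.inr (Or.inr ⟨h0, m, u.natDegree, P, u.eraseLead, z, y, u.leadingCoeff, γ, hP, hr,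
      ?_, ?_, Or.inl hlc, hz, ?_, rfl⟩)⟩
    · rw [← hzy, reduct_add, reduct_add, reduct_C_mul, ← hu', hw₃, hw₁]
      ring
    · exact (eraseLead_add_C_mul_X_pow u).symm
    · exact (degree_eraseLead_lt hu).trans_eq (degree_eq_natDegree hu)
    · rw [← hzy]
      refine (degree_sub_le _ _).trans_lt (max_lt hp₂ ?_)
      rw [← smul_eq_C_mul]
      exact (degree_smul_le _ _).trans_lt hr

end PolynomialReduction

/-! ### Certificates -/

section Certificate

variable {E : Type u} [Field E]

/-- The data `k₁ / k₂`, `A / B` and `q / b + v / k₂` certify that `q / b + v / k₂` is a residual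
form of `pS / qS` with respect to the kernel `pK / qK`. -/
structure IsCertificate (pK qK pS qS k₁ k₂ b q A B v : E[X]) : Prop where
  kernel : k₁ * qK = pK * k₂
  coprime : IsCoprime k₁ k₂
  monic_b : b.Monic
  coprime_b : IsCoprime b (k₂ * derivative b)
  degree_lt : q.degree < b.degree
  monic_B : B.Monic
  eq : pS * (B * B) * (k₂ * b) = qS * (((derivative A * B - A * derivative B) * k₂ +
    k₁ * A * B) * b + (q * k₂ + v * b) * (B * B))
  reduced : IsReduced k₁ k₂ v

/-- A certificate may contain any coprime fraction for the kernel. It differs from the normalized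
one by a nonzero constant, which changes neither the reduction subspace nor its degrees. -/
theorem exists_eq_C_mul_num_denom {k₁ k₂ p q : E[X]} (hq : q ≠ 0) (hk : IsCoprime k₁ k₂)
    (h : k₁ * q = p * k₂) {K : RatFunc E}
    (hK : K = algebraMap E[X] (RatFunc E) p / algebraMap E[X] (RatFunc E) q) :
    ∃ a : E, a ≠ 0 ∧ k₁ = C a * K.num ∧ k₂ = C a * K.denom := by
  have hd := K.denom_ne_zero
  have h1 : K.num * q = p * K.denom := by
    have cd := RatFunc.algebraMap_ne_zero (K := E) hd
    have cq := RatFunc.algebraMap_ne_zero (K := E) hq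
    apply RatFunc.algebraMap_injective E
    rw [← K.num_div_denom, div_eq_div_iff cd cq] at hK
    simpa only [map_mul] using hK
  have h2 : k₁ * K.denom = k₂ * K.num := by
    apply mul_right_cancel₀ hq
    linear_combination K.denom * h - k₂ * h1
  have h3 : K.denom ∣ k₂ := K.isCoprime_num_denom.symm.dvd_of_dvd_mul_right ⟨k₁, by
    rw [← h2, mul_comm]⟩
  have h4 : k₂ ∣ K.denom := hk.symm.dvd_of_dvd_mul_left ⟨K.num, h2⟩
  obtain ⟨u, hu⟩ := associated_of_dvd_dvd h3 h4
  obtain ⟨a, ha, hau⟩ := isUnit_iff.1 u.isUnit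
  refine ⟨a, ha.ne_zero, ?_, by rw [hau, ← hu, mul_comm]⟩
  apply mul_right_cancel₀ hd
  rw [h2, ← hu, hau]
  ring

theorem IsReduced.mem_standardComplement [CharZero E] {k₁ k₂ v : E[X]} (hv : IsReduced k₁ k₂ v)
    {K : RatFunc E} {a : E} (ha : a ≠ 0) (h₁ : k₁ = C a * K.num) (h₂ : k₂ = C a * K.denom) :
    v ∈ standardComplement (reductionSubspace K) := by
  apply mem_standardComplement_of_coeff
  intro f hf hf0
  obtain ⟨p, rfl⟩ := mem_reductionSubspace.1 hf
  have h : reduct k₁ k₂ p = C a * (K.denom * derivative p + K.num * p) := by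
    rw [reduct, h₁, h₂]
    ring
  rw [← natDegree_C_mul ha, ← h]
  apply hv.coeff_eq_zero
  rw [h]
  exact mul_ne_zero (C_ne_zero.2 ha) hf0

theorem IsCertificate.isResidualForm [CharZero E] {pK qK pS qS k₁ k₂ b q A B v : E[X]}
    (h : IsCertificate pK qK pS qS k₁ k₂ b q A B v) (hqK : qK ≠ 0) (hqS : qS ≠ 0)
    {K S : RatFunc E}
    (hK : K = algebraMap E[X] (RatFunc E) pK / algebraMap E[X] (RatFunc E) qK)
    (hS : S = algebraMap E[X] (RatFunc E) pS / algebraMap E[X] (RatFunc E) qS)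
    {g r : RatFunc E} (hg : g = algebraMap E[X] (RatFunc E) A / algebraMap E[X] (RatFunc E) B)
    (hr : r = algebraMap E[X] (RatFunc E) (q * k₂ + v * b) /
      algebraMap E[X] (RatFunc E) (b * k₂)) :
    b * k₂ ≠ 0 ∧ S = g′ + K * g + r ∧ IsResidualForm K r := by
  obtain ⟨a, ha, h₁, h₂⟩ := exists_eq_C_mul_num_denom hqK h.coprime h.kernel hK
  have ca : algebraMap E[X] (RatFunc E) (C a) ≠ 0 :=
    RatFunc.algebraMap_ne_zero (C_ne_zero.2 ha)
  have cd := RatFunc.algebraMap_ne_zero (K := E) K.denom_ne_zero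
  have hk₂ : k₂ ≠ 0 := by
    rw [h₂]
    exact mul_ne_zero (C_ne_zero.2 ha) K.denom_ne_zero
  have hb := h.monic_b.ne_zero
  have cB := RatFunc.algebraMap_ne_zero (K := E) h.monic_B.ne_zero
  have cb := RatFunc.algebraMap_ne_zero (K := E) hb
  have ck := RatFunc.algebraMap_ne_zero (K := E) hk₂
  have cS := RatFunc.algebraMap_ne_zero (K := E) hqS
  have hKk : K = algebraMap E[X] (RatFunc E) k₁ / algebraMap E[X] (RatFunc E) k₂ := by
    conv_lhs => rw [← K.num_div_denom]
    rw [h₁, h₂, map_mul, map_mul, mul_div_mul_left _ _ ca]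
  -- The factor `C a⁻¹` compensates for `k₂ = C a * K.denom`.
  refine ⟨mul_ne_zero hb hk₂, ?_, q, b, C a⁻¹ * v, ?_, ?_, h.degree_lt, ?_, ?_⟩
  · have e := congrArg (algebraMap E[X] (RatFunc E)) h.eq
    rw [hS, hg, ratFunc_deriv_div A h.monic_B.ne_zero, hKk, hr]
    simp only [map_mul, map_add, map_sub] at e ⊢
    field_simp
    linear_combination e
  · have : b.Separable := h.coprime_b.of_mul_right_right
    exact this.squarefree
  · have := h.coprime_b.of_mul_right_left
    rw [h₂] at this
    exact this.of_mul_right_right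
  · rw [← smul_eq_C_mul]
    exact Submodule.smul_mem _ _ (h.reduced.mem_standardComplement ha h₁ h₂)
  · have e : algebraMap E[X] (RatFunc E) (C a⁻¹) * algebraMap E[X] (RatFunc E) (C a) = 1 := by
      rw [← map_mul, ← C_mul, inv_mul_cancel₀ ha, C_1, map_one]
    rw [hr, h₂]
    generalize C a⁻¹ = a' at e ⊢
    simp only [map_mul, map_add]
    field_simp
    linear_combination (-algebraMap E[X] (RatFunc E) v * algebraMap E[X] (RatFunc E) b) * e

theorem exists_isCertificate [CharZero E] {pK qK pS qS : E[X]} (hqK : qK ≠ 0) (hqS : qS ≠ 0)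
    {K S : RatFunc E}
    (hK : K = algebraMap E[X] (RatFunc E) pK / algebraMap E[X] (RatFunc E) qK)
    (hS : S = algebraMap E[X] (RatFunc E) pS / algebraMap E[X] (RatFunc E) qS)
    (hSK : IsCoprime S.denom K.denom) :
    ∃ k₁ k₂ b q A B v, IsCertificate pK qK pS qS k₁ k₂ b q A B v := by
  obtain ⟨g, q, b, w, hb, hbs, hbk, hq, h⟩ := exists_hermite_reduction (k₁ := K.num)
    K.denom_ne_zero _ S.num S.denom rfl S.denom_ne_zero hSK
  obtain ⟨p, v, rfl, hv⟩ := exists_isReduced K.isCoprime_num_denom w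
  set G := g + algebraMap E[X] (RatFunc E) p with hG
  have cd := RatFunc.algebraMap_ne_zero (K := E) K.denom_ne_zero
  have cB := RatFunc.algebraMap_ne_zero (K := E) G.denom_ne_zero
  have cb := RatFunc.algebraMap_ne_zero (K := E) hb.ne_zero
  have cS := RatFunc.algebraMap_ne_zero (K := E) hqS
  have cK := RatFunc.algebraMap_ne_zero (K := E) hqK
  refine ⟨K.num, K.denom, b, q, G.num, G.denom, v, ?_, K.isCoprime_num_denom, hb, ?_, hq,
    G.monic_denom, ?_, hv⟩
  · apply RatFunc.algebraMap_injective E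
    rw [← K.num_div_denom, div_eq_div_iff cd cK] at hK
    simpa only [map_mul] using hK
  · exact hbk.mul_right hbs
  · apply RatFunc.algebraMap_injective E
    have h' : S = G′ + K * G + algebraMap E[X] (RatFunc E) q / algebraMap E[X] (RatFunc E) b +
        algebraMap E[X] (RatFunc E) v / algebraMap E[X] (RatFunc E) K.denom := by
      rw [S.num_div_denom, K.num_div_denom] at h
      rw [h, hG, ratFunc_deriv_add, RatFunc.deriv_algebraMap_polynomial, reduct]
      simp only [map_add, map_mul]
      have : K * algebraMap E[X] (RatFunc E) p = algebraMap E[X] (RatFunc E) K.num *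
          algebraMap E[X] (RatFunc E) p / algebraMap E[X] (RatFunc E) K.denom := by
        conv_lhs => rw [← K.num_div_denom]
        ring
      rw [mul_add, this]
      field_simp
      ring
    have hG' := ratFunc_deriv_div G.num G.denom_ne_zero
    rw [G.num_div_denom] at hG'
    have e1 := G.num_div_denom
    have e2 := K.num_div_denom
    rw [hS, hG'] at h'
    generalize G.num = A at *
    generalize G.denom = B at *
    rw [← e1, ← e2] at h'
    simp only [RatFunc.num_div_denom] at h'
    generalize K.num = k₁ at *
    generalize K.denom = k₂ at *
    simp only [map_mul, map_add, map_sub]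
    field_simp at h'
    linear_combination h' - algebraMap E[X] (RatFunc E) B * algebraMap E[X] (RatFunc E) b *
      algebraMap E[X] (RatFunc E) qS * algebraMap E[X] (RatFunc E) A * (div_eq_iff cd).1 e2

end Certificate

/-! ### The test for certificates -/

namespace PolyTerm

/-- The numerator of the kernel. -/
def kernelNum : PolyTerm := .add (.var 4) (.mul (.var 5) (.mono 4))

/-- The denominator of the kernel. -/
def kernelDenom : PolyTerm := .add (.var 6) (.mul (.var 7) (.mono 6))

/-- The squarefree denominator of the residual form. -/
def residualDenom : PolyTerm := .add (.mono 10) (.var 10)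

/-- The denominator of the rational function that is integrated. -/
def integralDenom : PolyTerm := .add (.mono 15) (.var 15)

/-- The monic polynomial whose reduction loses its expected leading term. -/
def exceptional : PolyTerm := .add (.var 19) (.mono 19)

end PolyTerm

namespace Test

open PolyTerm

/-- Equality of two polynomial expressions. -/
def eq (s t : PolyTerm) : Test := .isZero (.add s (.neg t))

theorem holds_eq {E : Type u} [Field E] {L : List (List E)} {s t : PolyTerm} :
    (eq s t).Holds L ↔ s.denote L = t.denote L := by
  rw [eq, Holds, denote, denote, ← sub_eq_add_neg, sub_eq_zero]

/-- The conditions that do not concern the degrees in `v`. -/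
def fraction : Test :=
  .and (eq (.mono 6) (.mul .indet (.mono 4)))
  (.and (eq (.mono 5) .indet)
  (.and (eq (.mono 7) .indet)
  (.and (eq (.mul kernelNum (.var 1)) (.mul (.var 0) kernelDenom))
  (.and (eq (.add (.mul (.var 8) kernelNum) (.mul (.var 9) kernelDenom)) .one)
  (.and (eq (.mono 11) (.mono 10))
  (.and (eq (.add (.mul (.var 12) residualDenom)
    (.mul (.var 13) (.mul kernelDenom (.deriv residualDenom)))) .one)
  (eq (.mul (.mul (.var 2) (.mul integralDenom integralDenom)) (.mul kernelDenom residualDenom))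
    (.mul (.var 3) (.add
      (.mul (.add (.mul (.add (.mul (.deriv (.var 14)) integralDenom)
        (.neg (.mul (.var 14) (.deriv integralDenom)))) kernelDenom)
        (.mul (.mul kernelNum (.var 14)) integralDenom)) residualDenom)
      (.mul (.add (.mul (.var 11) kernelDenom) (.mul (.var 16) residualDenom))
        (.mul integralDenom integralDenom)))))))))))

/-- The conditions on `v` if no polynomial is exceptional for polynomial reduction. -/
def regular : Test :=
  .and (.notNat 5 7) (.and (eq (.mono 27) (.mono 4)) (eq (.var 16) (.var 27)))

/-- The conditions on `v` if there is an exceptional polynomial. -/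
def singular : Test :=
  .and (eq (.add (.mul (.var 17) (.var 5)) (.mul (.var 18) (.var 7))) .one)
  (.and (eq (.mono 20) (.mono 4))
  (.and (eq (.var 20) (.add (.mul kernelDenom (.deriv exceptional)) (.mul kernelNum exceptional)))
  (.and (eq (.var 20) (.add (.var 21) (.mul (.var 22) (.mono 21))))
  (.and (eq (.mono 22) .indet)
  (.and (eq (.mul (.mul (.var 23) (.var 22)) (.var 20)) (.var 20))
  (.and (eq (.mono 24) (.mono 21))
  (.and (eq (.mono 27) (.mono 4))
  (.and (eq (.var 27) (.add (.var 24) (.mul (.mul .indet (.mono 21)) (.var 25))))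
  (.and (eq (.mono 26) .indet)
  (eq (.var 16) (.add (.var 27) (.mul (.var 26) (.mul (.mono 19) (.mono 4))))))))))))))

/-- The test for certificates. -/
def certificate : Test :=
  .and fraction (.or (.isZero (.var 16)) (.or regular singular))

end Test

/-! ### Polynomials as coefficient lists, and soundness of the test -/

section

variable {E : Type u} [Field E]

/-- With its converse `exists_polyOfList_eq` (padding by zeros), this turns degree bounds into
conditions on lengths, which the test compares as powers of `X`. -/
theorem degree_polyOfList_lt (l : List E) : (polyOfList l).degree < l.length := by
  induction l with
  | nil => simp [polyOfList]
  | cons a l ih =>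
    rw [degree_lt_iff_coeff_zero] at ih ⊢
    intro m hm
    rw [List.length_cons] at hm
    obtain ⟨m, rfl⟩ : ∃ k, m = k + 1 := ⟨m - 1, by omega⟩
    rw [polyOfList, coeff_add, coeff_X_mul, coeff_C_succ, zero_add]
    exact ih m (by omega)

theorem exists_polyOfList_eq {p : E[X]} {n : ℕ} (hp : p.degree < n) :
    ∃ l : List E, l.length = n ∧ polyOfList l = p := by
  induction n generalizing p with
  | zero => exact ⟨[], rfl, by
    rw [Nat.cast_zero, Nat.WithBot.lt_zero_iff, degree_eq_bot] at hp
    rw [hp, polyOfList]⟩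
  | succ n ih =>
    obtain ⟨l, hl, hl'⟩ := ih (p := p.divX) (by
      rw [degree_lt_iff_coeff_zero] at hp ⊢
      intro m hm
      rw [coeff_divX]
      exact hp _ (by omega))
    refine ⟨p.coeff 0 :: l, by simp [hl], ?_⟩
    rw [polyOfList, hl', add_comm, X_mul_divX_add]

theorem exists_polyOfList_eq' (p : E[X]) : ∃ l : List E, polyOfList l = p := by
  obtain ⟨l, -, hl⟩ := exists_polyOfList_eq (degree_lt_succ_of_natDegree_le (p := p) le_rfl)
  exact ⟨l, hl⟩

theorem X_pow_eq_X_pow_iff {m n : ℕ} : (X ^ m : E[X]) = X ^ n ↔ m = n :=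
  ⟨fun h => by simpa using congrArg natDegree h, fun h => by rw [h]⟩

theorem X_pow_eq_X_iff {m : ℕ} : (X ^ m : E[X]) = X ↔ m = 1 := by
  rw [← X_pow_eq_X_pow_iff (E := E), pow_one]

theorem X_pow_eq_X_mul_iff {m n : ℕ} : (X ^ m : E[X]) = X * X ^ n ↔ m = n + 1 := by
  rw [← X_pow_eq_X_pow_iff (E := E), pow_succ']

theorem coeff_add_C_mul_X_pow {p : E[X]} {n : ℕ} (hp : p.degree < n) (a : E) :
    (p + C a * X ^ n).natDegree ≤ n ∧ (p + C a * X ^ n).coeff n = a := by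
  constructor
  · exact natDegree_add_le_of_degree_le (natDegree_le_of_degree_le hp.le)
      (natDegree_C_mul_X_pow_le a n)
  · rw [coeff_add, (degree_lt_iff_coeff_zero _ _).1 hp _ le_rfl, coeff_C_mul_X_pow, if_pos rfl,
      zero_add]

theorem exists_eq_add_C_mul_X_pow {p : E[X]} {n : ℕ} (hp : p.natDegree ≤ n) :
    ∃ q : E[X], q.degree < n ∧ p = q + C (p.coeff n) * X ^ n := by
  refine ⟨p - C (p.coeff n) * X ^ n, ?_, by ring⟩
  apply degree_lt_of_natDegree_le_of_coeff
  · exact (natDegree_sub_le _ _).trans (max_le hp (natDegree_C_mul_X_pow_le _ _))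
  · rw [coeff_sub, coeff_C_mul_X_pow, if_pos rfl, sub_self]

theorem exists_eq_X_pow_add {p : E[X]} (hp : p.Monic) :
    ∃ l : List E, p = X ^ l.length + polyOfList l := by
  obtain ⟨q, hq, h⟩ := exists_eq_add_C_mul_X_pow (le_refl p.natDegree)
  obtain ⟨l, hl, rfl⟩ := exists_polyOfList_eq hq
  refine ⟨l, ?_⟩
  rw [coeff_natDegree, hp.leadingCoeff, C_1, one_mul] at h
  rw [hl, add_comm, ← h]

theorem polyOfList_of_length_eq_one {l : List E} (hl : l.length = 1) :
    polyOfList l = C (l.headD 0) := by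
  obtain ⟨a, rfl⟩ := List.length_eq_one_iff.1 hl
  simp [polyOfList]

open PolyTerm in
-- The entries of `L` are: 0–3 the input; 4, 5 and 6, 7 the lower part and top coefficient of `k₁`
-- and `k₂`, where the length of entry 4 is `D`; 8, 9 and 12, 13 Bézout coefficients; 10, 11 the
-- lower part of `b`, and `q`; 14, 15 `A` and the lower part of `B`; 16 `v`. In the exceptional case
-- 17, 18 show that the top coefficients are not both zero; 19 is `p` with length `m`; 20 is the
-- image of `p + X ^ m`, padded to length `D`; 21 is `u` with length `e`; 22, 23 are `ε` and an
-- inverse; 24–26 are `z`, `w`, `γ`. Entry 27, of length `D`, bounds the degree of `v`, or of `v`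
-- without its `γ` term.
theorem isReduced_of_holds {L : List (List E)} (h : Test.certificate.Holds L) :
    IsReduced (kernelNum.denote L) (kernelDenom.denote L) (polyOfList (L.getD 16 [])) := by
  obtain ⟨⟨h₁, h₂, h₃, -⟩, h⟩ := h
  rw [Test.holds_eq] at h₁ h₂ h₃
  simp only [denote, X_pow_eq_X_mul_iff, X_pow_eq_X_iff] at h₁ h₂ h₃
  have hα := polyOfList_of_length_eq_one h₂
  have hβ := polyOfList_of_length_eq_one h₃
  set α := (L.getD 5 []).headD 0 with hα'
  set β := (L.getD 7 []).headD 0 with hβ'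
  set D := (L.getD 4 []).length with hD
  have hk₁ : kernelNum.denote L = polyOfList (L.getD 4 []) + C α * X ^ D := by
    simp only [kernelNum, denote, hα, hD]
  have hk₂ : kernelDenom.denote L = polyOfList (L.getD 6 []) + C β * X ^ (D + 1) := by
    simp only [kernelDenom, denote, hβ, h₁]
  obtain ⟨d₁, c₁⟩ := coeff_add_C_mul_X_pow (degree_polyOfList_lt (L.getD 4 [])) α
  obtain ⟨d₂, c₂⟩ := coeff_add_C_mul_X_pow (degree_polyOfList_lt (L.getD 6 [])) β
  rw [h₁, ← hk₂] at d₂ c₂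
  rw [← hk₁] at d₁ c₁
  refine ⟨D, d₁, d₂, ?_⟩
  rcases h with h | ⟨hn, hl, hv⟩ | ⟨g₁, g₂, g₃, g₄, g₅, g₆, g₇, g₈, g₉, g₁₀, g₁₁⟩
  · exact Or.inl h
  · rw [Test.holds_eq] at hl hv
    simp only [denote, X_pow_eq_X_pow_iff] at hl hv
    refine Or.inr (Or.inl ⟨?_, fun n => ?_⟩)
    · rw [hv, hD, ← hl]
      exact degree_polyOfList_lt _
    · rw [reductCoeff, c₁, c₂]
      exact hn n
  · rw [Test.holds_eq] at g₁ g₂ g₃ g₄ g₅ g₆ g₇ g₈ g₉ g₁₀ g₁₁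
    have hP : exceptional.denote L =
        polyOfList (L.getD 19 []) + X ^ (L.getD 19 []).length := rfl
    simp only [denote, X_pow_eq_X_pow_iff, X_pow_eq_X_iff] at g₁ g₂ g₃ g₄ g₅ g₆ g₇ g₈ g₉ g₁₀ g₁₁
    rw [hP, ← reduct] at g₃
    have hε := polyOfList_of_length_eq_one g₅
    have hγ := polyOfList_of_length_eq_one g₁₀
    rw [hα, hβ] at g₁
    rw [hε] at g₄ g₆
    rw [hγ] at g₁₁
    refine Or.inr (Or.inr ⟨?_, (L.getD 19 []).length, (L.getD 21 []).length,
      polyOfList (L.getD 19 []), polyOfList (L.getD 21 []), polyOfList (L.getD 24 []),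
      polyOfList (L.getD 25 []), (L.getD 22 []).headD 0, (L.getD 26 []).headD 0,
      degree_polyOfList_lt _, ?_, ?_, degree_polyOfList_lt _, ?_, ?_, ?_, ?_⟩)
    · rw [c₁, c₂]
      by_contra! h
      rw [h.1, h.2] at g₁
      simp at g₁
    · rw [← g₃, hD, ← g₂]
      exact degree_polyOfList_lt _
    · rw [← g₃, g₄]
    -- If `ε = 0`, the identity `ε' ε R = R` of the test forces `R = 0`.
    · rw [← g₃]
      by_contra! h
      rw [h.1] at g₆
      simp only [C_0, mul_zero, zero_mul] at g₆
      exact h.2 g₆.symm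
    · rw [← g₇]
      exact degree_polyOfList_lt _
    · rw [pow_succ', ← g₉, hD, ← g₈]
      exact degree_polyOfList_lt _
    · rw [g₁₁, g₉, pow_succ', pow_add]

open PolyTerm in
theorem isCertificate_of_holds {L : List (List E)} (h : Test.certificate.Holds L) :
    IsCertificate (polyOfList (L.getD 0 [])) (polyOfList (L.getD 1 [])) (polyOfList (L.getD 2 []))
      (polyOfList (L.getD 3 [])) (kernelNum.denote L) (kernelDenom.denote L)
      (residualDenom.denote L) (polyOfList (L.getD 11 [])) (polyOfList (L.getD 14 []))
      (integralDenom.denote L) (polyOfList (L.getD 16 [])) := by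
  have hr := isReduced_of_holds h
  obtain ⟨⟨-, -, -, h₄, h₅, h₆, h₇, h₈⟩, -⟩ := h
  rw [Test.holds_eq] at h₄ h₅ h₆ h₇ h₈
  have hb : residualDenom.denote L = X ^ (L.getD 10 []).length + polyOfList (L.getD 10 []) := rfl
  have hB : integralDenom.denote L = X ^ (L.getD 15 []).length + polyOfList (L.getD 15 []) := rfl
  rw [denote, denote, X_pow_eq_X_pow_iff] at h₆
  refine ⟨h₄, ⟨_, _, h₅⟩, ?_, ⟨_, _, h₇⟩, ?_, ?_, ?_, hr⟩
  · rw [hb]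
    exact monic_X_pow_add (degree_polyOfList_lt _)
  · rw [hb, degree_add_eq_left_of_degree_lt (by simpa using degree_polyOfList_lt _), degree_X_pow,
      ← h₆]
    exact degree_polyOfList_lt _
  · rw [hB]
    exact monic_X_pow_add (degree_polyOfList_lt _)
  · simp only [denote] at h₈
    linear_combination h₈

end

-- Completeness of the test, and descent to the subfield generated by the input

universe v

section

variable {E : Type u} [Field E]

open PolyTerm in
-- Each existential statement in a certificate is replaced by explicit coefficient lists, padded to
-- the length the test expects. No field extension is needed, so the lists stay over the field of
-- the certificate.
theorem exists_holds {p₀ p₁ p₂ p₃ : List E} {k₁ k₂ b q A B v : E[X]}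
    (h : IsCertificate (polyOfList p₀) (polyOfList p₁) (polyOfList p₂) (polyOfList p₃)
      k₁ k₂ b q A B v) :
    ∃ C, Test.certificate.Holds (p₀ :: p₁ :: p₂ :: p₃ :: C) := by
  obtain ⟨hk, ⟨a₁, a₂, ha⟩, hb, ⟨x₁, x₂, hx⟩, hq, hB, heq, D, h₁, h₂, hv⟩ := h
  obtain ⟨l₄, h₄, h₄'⟩ : ∃ l : List E, l.length = D ∧
      k₁ = polyOfList l + C (k₁.coeff D) * X ^ D := by
    obtain ⟨p, hp, hp'⟩ := exists_eq_add_C_mul_X_pow h₁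
    obtain ⟨l, hl, rfl⟩ := exists_polyOfList_eq hp
    exact ⟨l, hl, hp'⟩
  obtain ⟨l₆, h₆, h₆'⟩ : ∃ l : List E, l.length = D + 1 ∧
      k₂ = polyOfList l + C (k₂.coeff (D + 1)) * X ^ (D + 1) := by
    obtain ⟨p, hp, hp'⟩ := exists_eq_add_C_mul_X_pow h₂
    obtain ⟨l, hl, rfl⟩ := exists_polyOfList_eq hp
    exact ⟨l, hl, hp'⟩
  obtain ⟨l₈, rfl⟩ := exists_polyOfList_eq' a₁
  obtain ⟨l₉, rfl⟩ := exists_polyOfList_eq' a₂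
  obtain ⟨l₁₀, h₁₀⟩ := exists_eq_X_pow_add hb
  obtain ⟨l₁₁, h₁₁, rfl⟩ : ∃ l : List E, l.length = l₁₀.length ∧ polyOfList l = q := by
    apply exists_polyOfList_eq
    rwa [h₁₀, degree_add_eq_left_of_degree_lt (by simpa using degree_polyOfList_lt _),
      degree_X_pow] at hq
  obtain ⟨l₁₂, rfl⟩ := exists_polyOfList_eq' x₁
  obtain ⟨l₁₃, rfl⟩ := exists_polyOfList_eq' x₂
  obtain ⟨l₁₄, rfl⟩ := exists_polyOfList_eq' A
  obtain ⟨l₁₅, h₁₅⟩ := exists_eq_X_pow_add hB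
  obtain ⟨l₁₆, rfl⟩ := exists_polyOfList_eq' v
  set α := k₁.coeff D with hα
  set β := k₂.coeff (D + 1) with hβ
  have hs : ∀ a : E, polyOfList [a] = C a := by simp [polyOfList]
  -- The tail `T`, from entry 17 on, depends on which of the three cases of reducedness occurs.
  obtain ⟨L, hL⟩ : ∃ L : List (List E) → List (List E), ∀ T, L T =
      p₀ :: p₁ :: p₂ :: p₃ :: l₄ :: [α] :: l₆ :: [β] :: l₈ :: l₉ :: l₁₀ :: l₁₁ :: l₁₂ :: l₁₃ ::
        l₁₄ :: l₁₅ :: l₁₆ :: T := ⟨_, fun T => rfl⟩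
  have hk₁ : ∀ T, kernelNum.denote (L T) = k₁ := by
    intro T
    rw [h₄', hL, ← hs, ← h₄]
    rfl
  have hk₂ : ∀ T, kernelDenom.denote (L T) = k₂ := by
    intro T
    rw [h₆', hL, ← hs, ← h₆]
    rfl
  have hb' : ∀ T, residualDenom.denote (L T) = b := by
    intro T
    rw [h₁₀, hL]
    rfl
  have hB' : ∀ T, integralDenom.denote (L T) = B := by
    intro T
    rw [h₁₅, hL]
    rfl
  have hF : ∀ T, Test.fraction.Holds (L T) := by
    intro T
    refine ⟨?_, ?_, ?_, ?_, ?_, ?_, ?_, ?_⟩ <;> rw [Test.holds_eq] <;>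
      simp only [denote, hk₁, hk₂, hb', hB'] <;> simp only [hL]
    · exact X_pow_eq_X_mul_iff.2 (h₆.trans (by rw [← h₄]; rfl))
    · exact X_pow_eq_X_iff.2 rfl
    · exact X_pow_eq_X_iff.2 rfl
    · exact hk
    · exact ha
    · exact X_pow_eq_X_pow_iff.2 h₁₁
    · exact hx
    · refine Eq.trans ?_ (heq.trans ?_)
      · rfl
      · simp only [List.getD_cons_succ, List.getD_cons_zero]
        ring
  suffices ∃ T, (Test.or (.isZero (.var 16)) (.or Test.regular Test.singular)).Holds (L T) by
    obtain ⟨T, hT⟩ := this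
    have := (⟨hF T, hT⟩ : Test.certificate.Holds (L T))
    rw [hL] at this
    exact ⟨_, this⟩
  rcases hv with hv | ⟨hv, hn⟩ | ⟨h0, m, e, P, u, z, w, ε, γ, hP, hr, hu, hue, hε, hz, hzw, hv⟩
  · refine ⟨[], Or.inl ?_⟩
    rw [hL]
    exact hv
  · obtain ⟨l₂₇, h₂₇, h₂₇'⟩ := exists_polyOfList_eq hv
    -- Ten empty lists fill the entries 17–26, which this case does not use.
    refine ⟨[[], [], [], [], [], [], [], [], [], [], l₂₇], Or.inr (Or.inl ⟨?_, ?_, ?_⟩)⟩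
    · rw [hL]
      exact hn
    · rw [Test.holds_eq, hL]
      exact X_pow_eq_X_pow_iff.2 (h₂₇.trans h₄.symm)
    · rw [Test.holds_eq, hL]
      exact h₂₇'.symm
  · obtain ⟨s, t, hst⟩ : ∃ s t : E[X], s * C α + t * C β = 1 := by
      rcases h0 with h0 | h0
      · exact ⟨C α⁻¹, 0, by rw [zero_mul, add_zero, ← C_mul, inv_mul_cancel₀ h0, C_1]⟩
      · exact ⟨0, C β⁻¹, by rw [zero_mul, zero_add, ← C_mul, inv_mul_cancel₀ h0, C_1]⟩
    obtain ⟨l₁₇, rfl⟩ := exists_polyOfList_eq' s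
    obtain ⟨l₁₈, rfl⟩ := exists_polyOfList_eq' t
    obtain ⟨l₁₉, h₁₉, rfl⟩ := exists_polyOfList_eq hP
    obtain ⟨l₂₀, h₂₀, h₂₀'⟩ := exists_polyOfList_eq hr
    obtain ⟨l₂₁, h₂₁, rfl⟩ := exists_polyOfList_eq hue
    obtain ⟨l₂₄, h₂₄, rfl⟩ := exists_polyOfList_eq hz
    obtain ⟨l₂₅, rfl⟩ := exists_polyOfList_eq' w
    obtain ⟨l₂₇, h₂₇, h₂₇'⟩ := exists_polyOfList_eq hzw
    obtain ⟨T, hT⟩ : ∃ T, T = [l₁₇, l₁₈, l₁₉, l₂₀, l₂₁, [ε], [ε⁻¹], l₂₄, l₂₅, [γ], l₂₇] :=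
      ⟨_, rfl⟩
    have hP' : exceptional.denote (L T) = polyOfList l₁₉ + X ^ m := by
      rw [← h₁₉, hL, hT]
      rfl
    refine ⟨T, Or.inr (Or.inr ⟨?_, ?_, ?_, ?_, ?_, ?_, ?_, ?_, ?_, ?_, ?_⟩)⟩ <;>
      rw [Test.holds_eq] <;> simp only [denote, hk₁, hk₂, hP'] <;> simp only [hL, hT]
    · refine Eq.trans ?_ hst
      rw [← hs, ← hs]
      rfl
    · exact X_pow_eq_X_pow_iff.2 (h₂₀.trans h₄.symm)
    · exact h₂₀'
    · refine h₂₀'.trans (hu.trans ?_)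
      rw [← hs, ← h₂₁]
      rfl
    · exact X_pow_eq_X_iff.2 rfl
    · change polyOfList [ε⁻¹] * polyOfList [ε] * polyOfList l₂₀ = polyOfList l₂₀
      rw [hs, hs, ← C_mul, h₂₀']
      rcases hε with hε | hε
      · rw [inv_mul_cancel₀ hε, C_1, one_mul]
      · rw [hε, mul_zero]
    · exact X_pow_eq_X_pow_iff.2 (h₂₄.trans h₂₁.symm)
    · exact X_pow_eq_X_pow_iff.2 (h₂₇.trans h₄.symm)
    · refine h₂₇'.trans ?_
      rw [pow_succ', ← h₂₁]
      rfl
    · exact X_pow_eq_X_iff.2 rfl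
    · refine hv.trans ?_
      rw [← h₂₇', ← hs, pow_add, ← h₁₉, ← h₄]
      rfl

theorem exists_map_subtype_eq {S : Subfield E} {l : List E} (h : ∀ x ∈ l, x ∈ S) :
    ∃ m : List S, m.map S.subtype = l := by
  induction l with
  | nil => exact ⟨[], rfl⟩
  | cons a l ih =>
    obtain ⟨m, hm⟩ := ih fun x hx => h x (by simp [hx])
    exact ⟨⟨a, h a (by simp)⟩ :: m, by rw [List.map_cons, hm]; rfl⟩

/-- Coprimality of reduced denominators descends along field extensions. -/
theorem isCoprime_denom_of_map {F : Type v} [Field F] (φ : F →+* E) {pK qK pS qS : F[X]}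
    (hqK : qK ≠ 0) (hqS : qS ≠ 0) {K S : RatFunc E}
    (hK : K = algebraMap E[X] (RatFunc E) (pK.map φ) / algebraMap E[X] (RatFunc E) (qK.map φ))
    (hS : S = algebraMap E[X] (RatFunc E) (pS.map φ) / algebraMap E[X] (RatFunc E) (qS.map φ))
    (hSK : IsCoprime S.denom K.denom) {K₀ S₀ : RatFunc F}
    (hK₀ : K₀ = algebraMap F[X] (RatFunc F) pK / algebraMap F[X] (RatFunc F) qK)
    (hS₀ : S₀ = algebraMap F[X] (RatFunc F) pS / algebraMap F[X] (RatFunc F) qS) :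
    IsCoprime S₀.denom K₀.denom := by
  have key : ∀ (p q : F[X]) (f : RatFunc E) (f₀ : RatFunc F), q ≠ 0 →
      f = algebraMap E[X] (RatFunc E) (p.map φ) / algebraMap E[X] (RatFunc E) (q.map φ) →
      f₀ = algebraMap F[X] (RatFunc F) p / algebraMap F[X] (RatFunc F) q →
      f₀.denom.map φ ∣ f.denom := by
    intro p q f f₀ hq hf hf₀
    have cd := RatFunc.algebraMap_ne_zero (K := F) f₀.denom_ne_zero
    have cq := RatFunc.algebraMap_ne_zero (K := F) hq
    have h : f₀.num * q = p * f₀.denom := by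
      apply RatFunc.algebraMap_injective F
      rw [← f₀.num_div_denom, div_eq_div_iff cd cq] at hf₀
      simpa only [map_mul] using hf₀
    obtain ⟨a, ha, -, h₂⟩ := exists_eq_C_mul_num_denom
      ((Polynomial.map_ne_zero_iff φ.injective).2 hq)
      ((isCoprime_map φ).2 f₀.isCoprime_num_denom)
      (by rw [← Polynomial.map_mul, h, Polynomial.map_mul]) hf
    rw [h₂]
    exact (isUnit_C.2 ha.isUnit).mul_left_dvd.2 dvd_rfl
  rw [← isCoprime_map φ]
  exact (hSK.of_isCoprime_of_dvd_left (key _ _ _ _ hqS hS hS₀)).of_isCoprime_of_dvd_right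
    (key _ _ _ _ hqK hK hK₀)

/-- Certificates exist already over the field that is generated by the input. -/
theorem exists_holds_of_isCoprime [CharZero E] {p₀ p₁ p₂ p₃ : List E} (h₁ : polyOfList p₁ ≠ 0)
    (h₃ : polyOfList p₃ ≠ 0) {K S : RatFunc E}
    (hK : K = algebraMap E[X] (RatFunc E) (polyOfList p₀) /
      algebraMap E[X] (RatFunc E) (polyOfList p₁))
    (hS : S = algebraMap E[X] (RatFunc E) (polyOfList p₂) /
      algebraMap E[X] (RatFunc E) (polyOfList p₃))
    (hSK : IsCoprime S.denom K.denom) :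
    ∃ C : List (List E), (∀ l ∈ C, ∀ x ∈ l,
      x ∈ Subfield.closure {y : E | y ∈ p₀ ∨ y ∈ p₁ ∨ y ∈ p₂ ∨ y ∈ p₃}) ∧
      Test.certificate.Holds (p₀ :: p₁ :: p₂ :: p₃ :: C) := by
  set F := Subfield.closure {y : E | y ∈ p₀ ∨ y ∈ p₁ ∨ y ∈ p₂ ∨ y ∈ p₃} with hF
  have hsub : ∀ y : E, (y ∈ p₀ ∨ y ∈ p₁ ∨ y ∈ p₂ ∨ y ∈ p₃) → y ∈ F :=
    fun y hy => Subfield.subset_closure hy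
  -- The definition of `F` mentions the input lists; it has to be forgotten before these are
  -- replaced by images of lists over `F`.
  clear_value F
  obtain ⟨m₀, rfl⟩ := exists_map_subtype_eq (S := F) (l := p₀) fun x hx =>
    hsub x (by simp only [hx, true_or])
  obtain ⟨m₁, rfl⟩ := exists_map_subtype_eq (S := F) (l := p₁) fun x hx =>
    hsub x (by simp only [hx, true_or, or_true])
  obtain ⟨m₂, rfl⟩ := exists_map_subtype_eq (S := F) (l := p₂) fun x hx =>
    hsub x (by simp only [hx, true_or, or_true])
  obtain ⟨m₃, rfl⟩ := exists_map_subtype_eq (S := F) (l := p₃) fun x hx =>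
    hsub x (by simp only [hx, or_true])
  rw [polyOfList_map] at h₁ h₃
  rw [polyOfList_map, polyOfList_map] at hK hS
  have h₁' : polyOfList m₁ ≠ 0 := fun h => h₁ (by rw [h, Polynomial.map_zero])
  have h₃' : polyOfList m₃ ≠ 0 := fun h => h₃ (by rw [h, Polynomial.map_zero])
  obtain ⟨k₁, k₂, b, q, A, B, v, h⟩ := exists_isCertificate h₁' h₃' rfl rfl
    (isCoprime_denom_of_map F.subtype h₁' h₃' hK hS hSK rfl rfl)
  obtain ⟨C, hC⟩ := exists_holds h
  refine ⟨C.map (List.map F.subtype), ?_, by simpa only [List.map_cons] using hC.map F.subtype⟩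
  intro l hl x hx
  obtain ⟨l, -, rfl⟩ := List.mem_map.1 hl
  obtain ⟨y, -, rfl⟩ := List.mem_map.1 hx
  exact y.2

end

/-! ### Independence of the field and the main theorem -/

section Extension

variable {E : Type u} {Φ : Type v} [Field E] [Field Φ] [Differential Φ] [Algebra (RatFunc E) Φ]

theorem IsExpIntegral.deriv {f : RatFunc E} {H : Φ} (h : IsExpIntegral f H) :
    H′ = algebraMap (RatFunc E) Φ f * H :=
  (div_eq_iff h.1).1 h.2

theorem IsExpIntegral.deriv_mul [DifferentialAlgebra (RatFunc E) Φ] {K : RatFunc E} {T : Φ}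
    (hT : IsExpIntegral K T) (g : RatFunc E) :
    (algebraMap (RatFunc E) Φ g * T)′ = algebraMap (RatFunc E) Φ (g′ + K * g) * T := by
  rw [Derivation.leibniz, smul_eq_mul, smul_eq_mul, hT.deriv, deriv_algebraMap, map_add, map_mul]
  ring

theorem IsExpIntegral.deriv_mul_add_eq_iff [DifferentialAlgebra (RatFunc E) Φ] {K S : RatFunc E}
    {H T : Φ} (hT : IsExpIntegral K T) (hH : H = algebraMap (RatFunc E) Φ S * T)
    (g r : RatFunc E) :
    H = (algebraMap (RatFunc E) Φ g * T)′ + algebraMap (RatFunc E) Φ r * T ↔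
      S = g′ + K * g + r := by
  rw [hT.deriv_mul, hH, ← add_mul, ← map_add, mul_left_inj' hT.1,
    (algebraMap (RatFunc E) Φ).injective.eq_iff]

/-- A hyperexponential function `S T`, where `T` has logarithmic derivative `K`, is integrable if
and only if `S = g' + K g` has a solution. -/
theorem isHyperexpIntegrable_iff [DifferentialAlgebra (RatFunc E) Φ] {K S : RatFunc E} {H T : Φ}
    (hT : IsExpIntegral K T) (hH : H = algebraMap (RatFunc E) Φ S * T) (hH0 : H ≠ 0) :
    IsHyperexpIntegrable E H ↔ ∃ g : RatFunc E, S = g′ + K * g := by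
  constructor
  · rintro ⟨G, ⟨φ, hφ⟩, hG⟩
    have hGφ := hφ.deriv
    rw [hG] at hGφ
    -- From `H = G′ = φ G` and `H ≠ 0` follows `G = H / φ = (S / φ) T`, a rational multiple of `T`.
    have hφ0 : algebraMap (RatFunc E) Φ φ ≠ 0 := left_ne_zero_of_mul (hGφ ▸ hH0)
    have hGT : G = algebraMap (RatFunc E) Φ (S / φ) * T := by
      rw [map_div₀]
      field_simp
      rw [← hH, hGφ]
      ring
    refine ⟨S / φ, ?_⟩
    have := (hT.deriv_mul_add_eq_iff hH (S / φ) 0).1 (by rw [← hGT, hG]; simp)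
    rwa [add_zero] at this
  · rintro ⟨g, hg⟩
    have h : H = (algebraMap (RatFunc E) Φ g * T)′ := by
      rw [hT.deriv_mul, ← hg, hH]
    have hg0 : algebraMap (RatFunc E) Φ g ≠ 0 := by
      intro h0
      rw [h0, zero_mul] at h
      exact hH0 (h.trans (Derivation.map_zero _))
    -- The antiderivative `g T` is nonzero because its derivative `S T` is, and its logarithmic
    -- derivative is `S T / (g T) = S / g`.
    refine ⟨_, ⟨S / g, mul_ne_zero hg0 hT.1, ?_⟩, h.symm⟩
    rw [← h, hH, map_div₀]
    have := hT.1
    field_simp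

end Extension

theorem IsResidualForm.zero {E : Type u} [Field E] (K : RatFunc E) : IsResidualForm K 0 :=
  ⟨0, 1, 0, squarefree_one, isCoprime_one_left, by simp, Submodule.zero_mem _, by simp⟩

end Hyperexp

theorem mainTheorem1 :
    ∃ A : Hyperexp.Program,
      ∀ (E : Type*) [Field E] [CharZero E]
        (Φ : Type*) [Field Φ] [Differential Φ] [Algebra (RatFunc E) Φ]
        [DifferentialAlgebra (RatFunc E) Φ]
        (H T : Φ) (f K S : RatFunc E),
        Hyperexp.IsExpIntegral f H →
        Hyperexp.IsKernelShell f K S →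
        Hyperexp.IsExpIntegral K T →
        H = algebraMap (RatFunc E) Φ S * T →
        ∀ dK dS : Hyperexp.Datum E, dK.Represents K → dS.Represents S →
          ∃ (h r : RatFunc E) (dh dr : Hyperexp.Datum E),
            A.eval (Hyperexp.Datum.pair dK dS) = Part.some (Hyperexp.Datum.pair dh dr) ∧
            dh.Represents h ∧ dr.Represents r ∧
            Hyperexp.IsResidualFormOf K S r ∧
            H = (algebraMap (RatFunc E) Φ h * T)′ + algebraMap (RatFunc E) Φ r * T ∧
            (∀ h' r' : RatFunc E, Hyperexp.IsResidualForm K r' →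
              H = (algebraMap (RatFunc E) Φ h' * T)′ + algebraMap (RatFunc E) Φ r' * T →
              r' = r) ∧
            (Hyperexp.IsHyperexpIntegrable E H ↔ r = 0) := by
  open Hyperexp PolyTerm in
  -- The two results are `A / B` and `(q k₂ + v b) / (b k₂)`, read off the certificate that is
  -- found.
  refine ⟨Program.certificateSearch Test.certificate (.var 14) integralDenom
    (.add (.mul (.var 11) kernelDenom) (.mul (.var 16) residualDenom))
    (.mul residualDenom kernelDenom), ?_⟩
  intro E _ _ Φ _ _ _ _ H T f K S hH hKS hT hHT dK dS hdK hdS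
  obtain ⟨p₀, p₁, rfl, h₁, hK⟩ := hdK
  obtain ⟨p₂, p₃, rfl, h₃, hS⟩ := hdS
  obtain ⟨C, hC, hC'⟩ := exists_holds_of_isCoprime h₁ h₃ hK hS hKS.coprime
  obtain ⟨L, hL, a, b, c, d, heval, ha, hb, hc, hd⟩ := Program.eval_certificateSearch hC hC'
    (.var 14) integralDenom
    (.add (.mul (.var 11) kernelDenom) (.mul (.var 16) residualDenom))
    (.mul residualDenom kernelDenom)
  have hcert := isCertificate_of_holds hL
  obtain ⟨hd0, hSr, hr⟩ := hcert.isResidualForm h₁ h₃ hK hS rfl rfl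
  set g := algebraMap (Polynomial E) (RatFunc E) (polyOfList a) /
    algebraMap (Polynomial E) (RatFunc E) (polyOfList b) with hg
  set r := algebraMap (Polynomial E) (RatFunc E) (polyOfList c) /
    algebraMap (Polynomial E) (RatFunc E) (polyOfList d) with hr'
  have hb0 : polyOfList b ≠ 0 := by
    rw [hb]
    exact hcert.monic_B.ne_zero
  have hd0' : polyOfList d ≠ 0 := by
    rw [hd]
    exact hd0
  have hSr' : S = g′ + K * g + r := by
    rw [hg, hr', ha, hb, hc, hd]
    exact hSr
  have hres : IsResidualForm K r := by
    rw [hr', hc, hd]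
    exact hr
  have huniq : ∀ h' r' : RatFunc E, IsResidualForm K r' → S = h'′ + K * h' + r' → r' = r := by
    intro h' r' hr₁ h
    refine hr₁.unique hKS.reduced hres (g := g + -h') ?_
    have hneg : (-h')′ = -h'′ := by
      have := ratFunc_deriv_add h' (-h')
      rw [add_neg_cancel, ratFunc_deriv_zero] at this
      exact (neg_eq_of_add_eq_zero_right this.symm).symm
    rw [ratFunc_deriv_add, hneg]
    linear_combination h - hSr'
  refine ⟨g, r, _, _, heval, ⟨a, b, rfl, hb0, rfl⟩, ⟨c, d, rfl, hd0', rfl⟩, ⟨⟨g, hSr'⟩, hres⟩,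
    (hT.deriv_mul_add_eq_iff hHT g r).2 hSr', ?_, ?_⟩
  · intro h' r' hr₁ h
    exact huniq h' r' hr₁ ((hT.deriv_mul_add_eq_iff hHT h' r').1 h)
  · rw [isHyperexpIntegrable_iff hT hHT hH.1]
    constructor
    · rintro ⟨h', h⟩
      -- A solution of `S = h'′ + K * h'` exhibits `0` as a residual form of `S`, so uniqueness
      -- gives `r = 0`.
      exact (huniq h' 0 (IsResidualForm.zero K) (by rw [add_zero, ← h])).symm
    · intro h0
      exact ⟨g, by rw [h0, add_zero] at hSr'; exact hSr'⟩
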